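/- Let $S_{\mathbb N}$ be the countable group of all finite permutations of $\mathbb N$ (those moving only finitely many points), and let $L(S_{\mathbb N})$ be the set of all its subgroups, with the compact topology induced from $\{0,1\}^{S_{\mathbb N}}$ and its Borel $\sigma$-algebra. The group acts on $L(S_{\mathbb N})$ by conjugation, $H\mapsto gHg^{-1}$ (the adjoint action); measures invariant under it are called AD-invariant. For an AD-invariant probability measure $\mu$ on $L(S_{\mathbb N})$ put $\chi_\mu(g)=\mu\{H: gHg^{-1}=H\}$, $g\in S_{\mathbb N}$; two such measures $\mu_1,\mu_2$ are called congruent if $\chi_{\mu_1}=\chi_{\mu_2}$. A signed partition $\eta$ of $\mathbb N$ is a partition of $\mathbb N$ whose set of blocks is decomposed as $\mathcal B^+\cup\mathcal B^-\cup\mathcal B^0$ (positive, negative and single-point blocks), where $\mathcal B^0$ is the set of all single-point blocks. Its signed Young subgroup is $Y_\eta=\prod_{B\in\mathcal B^+}S^+(B)\times\prod_{B\in\mathcal B^-}S^-(B)\subset S_{\mathbb N}$ (restricted direct product), where $S^+(B)$ is the group of finite permutations of $B$ and $S^-(B)$ is its subgroup of even permutations. Let $\alpha=(\alpha_i)_{i\in\mathbb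 Z}$ be a sequence of nonnegative numbers with $\alpha_1\ge\alpha_2\ge\dots$, $\alpha_{-1}\ge\alpha_{-2}\ge\dots$ and $\sum_{i\in\mathbb Z}\alpha_i=1$. Let $\xi=(\xi_n)_{n\in\mathbb N}$ be independent $\mathbb Z$-valued random variables with $\operatorname{Prob}\{\xi_n=v\}=\alpha_v$, and let $\eta(\xi)$ be the signed partition of $\mathbb N$ whose positive blocks are the sets $B_i=\{n:\xi_n=i\}$ with $i>0$, whose negative blocks are the sets $B_i$ with $i<0$, and in which the set $B_0$ is split into single points (empty $B_i$ are discarded, and a one-point $B_i$ counts as a single-point block). Let $\nu_\alpha$ be the law of the random subgroup $Y_{\eta(\xi)}$. Theorem. For every such $\alpha$, $\nu_\alpha$ is a Borel probability measure on $L(S_{\mathbb N})$ that is AD-invariant and ergodic for the adjoint action. Conversely, every ergodic AD-invariant Borel probability measure on $L(S_{\mathbb N})$ is congruent to $\nu_\alpha$ for some such $\alpha$. -/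

import Mathlib

open MeasureTheory
open scoped Pointwise

noncomputable section

/-! ### The lattice of subgroups of a group and its adjoint action -/

section SubgroupLattice

variable {G : Type*} [Group G]

open Classical in
/-- The indicator function of a subgroup, as a point of the compact space `{0,1}^G`. -/
def subgroupIndicator (H : Subgroup G) : G → Bool := fun g => decide (g ∈ H)

/-- The usual topology on the lattice of subgroups: the one induced from the
product space `{0,1}^G` (pointwise convergence of indicator functions). -/
instance subgroupLatticeTopology : TopologicalSpace (Subgroup G) :=
  TopologicalSpace.induced subgroupIndicator inferInstance

/-- The Borel structure on the lattice of subgroups. -/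
instance subgroupLatticeMeasurableSpace : MeasurableSpace (Subgroup G) :=
  borel (Subgroup G)

instance subgroupLatticeBorelSpace : BorelSpace (Subgroup G) := ⟨rfl⟩

/-- `μ` is an ergodic AD-invariant probability measure on the lattice of subgroups of `G`: a Borel
probability measure, invariant and ergodic for the adjoint action `H ↦ g H g⁻¹` of `G`
(the pointwise action of `ConjAct G` on `Subgroup G`). -/
structure IsErgodicADMeasure (μ : Measure (Subgroup G)) : Prop where
  isProbabilityMeasure : IsProbabilityMeasure μ
  ergodic : ErgodicSMul (ConjAct G) (Subgroup G) μ

/-- The character of an AD-invariant measure: the function `χ(g) = μ {x : g x = x}` attached to the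
action of `G` on the subgroup lattice, that is `χ_μ(g) = μ {H : g H g⁻¹ = H}`. -/
def adCharacter (μ : Measure (Subgroup G)) (g : G) : ℝ :=
  μ.real {H : Subgroup G | ConjAct.toConjAct g • H = H}

/-- Two measures on the subgroup lattice are congruent if their characters are equal. -/
def ADCongruent (μ₁ μ₂ : Measure (Subgroup G)) : Prop :=
  ∀ g : G, adCharacter μ₁ g = adCharacter μ₂ g

end SubgroupLattice

/-! ### The infinite symmetric group and its signed Young subgroups -/

/-- The finitary permutations of `ℕ`, as a subgroup of the group of all permutations. -/
def finitaryPerm : Subgroup (Equiv.Perm ℕ) where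
  carrier := {g | {n | g n ≠ n}.Finite}
  one_mem' := by simp
  mul_mem' := by
    intro a b ha hb
    refine (Set.Finite.union ha hb).subset ?_
    intro n hn
    by_contra h
    simp only [Set.mem_union, Set.mem_ofPred_eq, not_or, not_not] at h
    exact hn (by rw [Equiv.Perm.mul_apply, h.2, h.1])
  inv_mem' := by
    intro a ha
    refine Set.Finite.subset ha ?_
    intro n hn h
    exact hn (by rw [Equiv.Perm.inv_eq_iff_eq, h])

/-- The infinite symmetric group: the countable group of all finite permutations of `ℕ`. -/
abbrev SInf : Type := ↥finitaryPerm

namespace SInf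

/-- The finite set of points moved by `g`. -/
def moved (g : SInf) : Finset ℕ :=
  Set.Finite.toFinset (s := {n | g.1 n ≠ n}) g.2

theorem mem_moved (g : SInf) (n : ℕ) : n ∈ g.moved ↔ g.1 n ≠ n :=
  Set.Finite.mem_toFinset (s := {n | g.1 n ≠ n}) g.2

theorem apply_mem_iff (g : SInf) (s : Finset ℕ) (hs : g.moved ⊆ s) (n : ℕ) :
    g.1 n ∈ s ↔ n ∈ s := by
  by_cases h : g.1 n = n
  · rw [h]
  · have h1 : n ∈ s := hs ((g.mem_moved n).2 h)
    have h2 : g.1 n ∈ s := hs ((g.mem_moved _).2 fun h' => h (g.1.injective h'))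
    exact iff_of_true h2 h1

/-- The restriction of `g` to a finite set that contains all points moved by `g`. -/
def restrict (g : SInf) (s : Finset ℕ) (hs : g.moved ⊆ s) : Equiv.Perm {n // n ∈ s} :=
  g.1.subtypePerm (g.apply_mem_iff s hs)

theorem sign_restrict (g : SInf) (s : Finset ℕ) (hs : g.moved ⊆ s) :
    Equiv.Perm.sign (g.restrict s hs) =
      Equiv.Perm.sign (g.restrict g.moved (Finset.Subset.refl _)) := by
  symm
  refine Equiv.Perm.sign_bij (fun x _ => ⟨x.1, hs x.2⟩) ?_ ?_ ?_
  · intro x _ _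
    rfl
  · intro x y _ _ h
    exact Subtype.ext (congrArg (fun z => z.1) h)
  · intro y hy
    have hy' : g.1 y.1 ≠ y.1 := fun h => hy (Subtype.ext h)
    exact ⟨⟨y.1, (g.mem_moved _).2 hy'⟩,
      fun h => hy' (congrArg (fun z => z.1) h), rfl⟩

/-- The sign of a finite permutation of `ℕ`: the sign of its restriction to the finite set of
points that it moves. -/
def sign : SInf →* ℤˣ where
  toFun g := Equiv.Perm.sign (g.restrict g.moved (Finset.Subset.refl _))
  map_one' := by
    have : (1 : SInf).restrict (1 : SInf).moved (Finset.Subset.refl _) = 1 := by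
      ext x
      rfl
    rw [this, map_one]
  map_mul' := by
    intro g h
    have hg : g.moved ⊆ g.moved ∪ h.moved := Finset.subset_union_left
    have hh : h.moved ⊆ g.moved ∪ h.moved := Finset.subset_union_right
    have hgh : (g * h).moved ⊆ g.moved ∪ h.moved := by
      intro n hn
      by_contra hc
      rw [Finset.mem_union, mem_moved, mem_moved, not_or, not_not, not_not] at hc
      refine ((g * h).mem_moved n).1 hn ?_
      change g.1 (h.1 n) = n
      rw [hc.2, hc.1]
    rw [← sign_restrict g _ hg, ← sign_restrict h _ hh, ← sign_restrict (g * h) _ hgh,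
      ← Equiv.Perm.sign_mul]
    rfl

/-- `S⁺(B)`: all finite permutations of the elements of `B ⊆ ℕ`, extended by the identity. -/
def symOn (B : Set ℕ) : Subgroup SInf where
  carrier := {g | ∀ n, n ∉ B → g.1 n = n}
  one_mem' := fun _ _ => rfl
  mul_mem' := by
    intro a b ha hb n hn
    change a.1 (b.1 n) = n
    rw [hb n hn, ha n hn]
  inv_mem' := by
    intro a ha n hn
    change (a.1)⁻¹ n = n
    rw [Equiv.Perm.inv_eq_iff_eq, ha n hn]

/-- `S⁻(B)`: the alternating group on `B ⊆ ℕ`, the even elements of `S⁺(B)`. -/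
def altOn (B : Set ℕ) : Subgroup SInf := symOn B ⊓ sign.ker

end SInf

/-- A signed partition of `ℕ`: a partition together with a decomposition of its set of blocks into
positive blocks, negative blocks and the set of all single-point blocks. -/
structure SignedPartition where
  /-- the positive blocks -/
  pos : Set (Set ℕ)
  /-- the negative blocks -/
  neg : Set (Set ℕ)
  /-- the single-point blocks -/
  zero : Set (Set ℕ)
  isPartition : Setoid.IsPartition (pos ∪ neg ∪ zero)
  disjoint_pos_neg : Disjoint pos neg
  nontrivial_of_mem_pos : ∀ B ∈ pos, B.Nontrivial
  nontrivial_of_mem_neg : ∀ B ∈ neg, B.Nontrivial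
  singleton_of_mem_zero : ∀ B ∈ zero, ∃ n, B = {n}

/-- The signed Young subgroup `Y_η`: the (restricted, internal) direct product of the groups
`S⁺(B)` over the positive blocks `B` and `S⁻(B)` over the negative blocks `B`. The factors have
disjoint supports, so this is the subgroup of the infinite symmetric group that they generate. -/
def SignedPartition.youngSubgroup (η : SignedPartition) : Subgroup SInf :=
  (⨆ B ∈ η.pos, SInf.symOn B) ⊔ (⨆ B ∈ η.neg, SInf.altOn B)

/-! ### The random signed Young subgroups -/

/-- The set `{n : ξ n = i}`. -/
def levelBlock (ξ : ℕ → ℤ) (i : ℤ) : Set ℕ := {n | ξ n = i}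

/-- The signed partition `η(ξ)` of an integer sequence `ξ`: the sets `{n : ξ n = i}` are positive
blocks for `i > 0` and negative blocks for `i < 0`, and the set `{n : ξ n = 0}` is split into
single-point blocks. (A set `{n : ξ n = i}`, `i ≠ 0`, that has a single point is a
single-point block, and an empty one is no block.) -/
def signedPartitionOf (ξ : ℕ → ℤ) : SignedPartition where
  pos := {B | ∃ i : ℤ, 0 < i ∧ B = levelBlock ξ i ∧ B.Nontrivial}
  neg := {B | ∃ i : ℤ, i < 0 ∧ B = levelBlock ξ i ∧ B.Nontrivial}
  zero := {B | ∃ n : ℕ, B = {n} ∧ (ξ n = 0 ∨ levelBlock ξ (ξ n) = {n})}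
  isPartition := by
    constructor
    · rintro ((⟨i, _, _, h⟩ | ⟨i, _, _, h⟩) | ⟨n, h, _⟩)
      · exact Set.not_nontrivial_empty h
      · exact Set.not_nontrivial_empty h
      · exact Set.singleton_ne_empty n h.symm
    · intro n
      by_cases hz : ξ n = 0 ∨ levelBlock ξ (ξ n) = {n}
      · refine ⟨{n}, ⟨Or.inr ⟨n, rfl, hz⟩, rfl⟩, ?_⟩
        have key : ∀ i : ℤ, i ≠ 0 → (levelBlock ξ i).Nontrivial → n ∉ levelBlock ξ i := by
          intro i hi hB hn
          have hn' : ξ n = i := hn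
          rcases hz with hz | hz
          · exact hi (hn'.symm.trans hz)
          · rw [hn'] at hz
            rw [hz] at hB
            exact Set.not_nontrivial_singleton hB
        rintro B ⟨(⟨i, hi, rfl, hB⟩ | ⟨i, hi, rfl, hB⟩) | ⟨m, rfl, _⟩, hn⟩
        · exact absurd hn (key i hi.ne' hB)
        · exact absurd hn (key i hi.ne hB)
        · rw [Set.mem_singleton_iff.1 hn]
      · rw [not_or] at hz
        have hmem : n ∈ levelBlock ξ (ξ n) := rfl
        have hnt : (levelBlock ξ (ξ n)).Nontrivial := by
          rw [Set.nontrivial_iff_ne_singleton hmem]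
          exact hz.2
        refine ⟨levelBlock ξ (ξ n), ⟨Or.inl ?_, hmem⟩, ?_⟩
        · rcases lt_or_gt_of_ne hz.1 with h | h
          · exact Or.inr ⟨ξ n, h, rfl, hnt⟩
          · exact Or.inl ⟨ξ n, h, rfl, hnt⟩
        · rintro B ⟨(⟨i, hi, rfl, hB⟩ | ⟨i, hi, rfl, hB⟩) | ⟨m, rfl, hm⟩, hn⟩
          · rw [show ξ n = i from hn]
          · rw [show ξ n = i from hn]
          · rw [← Set.mem_singleton_iff.1 hn] at hm
            exact absurd hm (not_or.2 hz)
  disjoint_pos_neg := by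
    rw [Set.disjoint_left]
    rintro B ⟨i, hi, hB, ⟨x, hx, _⟩⟩ ⟨j, hj, hB', _⟩
    have h1 : ξ x = i := by rw [hB] at hx; exact hx
    have h2 : ξ x = j := by rw [hB'] at hx; exact hx
    omega
  nontrivial_of_mem_pos := by
    rintro B ⟨_, _, _, h⟩
    exact h
  nontrivial_of_mem_neg := by
    rintro B ⟨_, _, _, h⟩
    exact h
  singleton_of_mem_zero := by
    rintro B ⟨n, h, _⟩
    exact ⟨n, h⟩

/-- The parameters: sequences `(α_i)`, `i ∈ ℤ`, of nonnegative numbers with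
`α_1 ≥ α_2 ≥ …`, `α_{-1} ≥ α_{-2} ≥ …` and `∑ α_i = 1`. -/
structure ThomaParameter where
  /-- the sequence -/
  val : ℤ → ℝ
  nonneg : ∀ i, 0 ≤ val i
  anti_pos : ∀ i, 0 < i → val (i + 1) ≤ val i
  anti_neg : ∀ i, 0 < i → val (-(i + 1)) ≤ val (-i)
  hasSum : HasSum val 1

namespace ThomaParameter

variable (α : ThomaParameter)

/-- The distribution on `ℤ` that gives mass `α_v` to `v`. -/
def pmf : PMF ℤ :=
  ⟨fun v => ENNReal.ofReal (α.val v), by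
    have h := ENNReal.summable (f := fun v => ENNReal.ofReal (α.val v)) |>.hasSum
    rwa [← ENNReal.ofReal_tsum_of_nonneg α.nonneg α.hasSum.summable, α.hasSum.tsum_eq,
      ENNReal.ofReal_one] at h⟩

/-- The Bernoulli measure `μ_α` on `ℤ^ℕ`: the law of a sequence of independent integer-valued
random variables `ξ_n` with `Prob {ξ_n = v} = α_v`. -/
def bernoulli : Measure (ℕ → ℤ) := Measure.infinitePi fun _ : ℕ => α.pmf.toMeasure

/-- The measure `ν_α` on the lattice of subgroups: the law of the random signed Young subgroup
`Y_{η(ξ)}`, where `ξ` has the law `μ_α`. -/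
def nu : Measure (Subgroup SInf) :=
  α.bernoulli.map fun ξ => (signedPartitionOf ξ).youngSubgroup

end ThomaParameter

end

/-! The measure `α.nu` inherits invariance and ergodicity from the Bernoulli measure: permuting the
labels `ξ` conjugates the Young subgroup, so the Hewitt–Savage law applies.

For the converse, call two points equivalent under `H` if they share an orbit or are both fixed by
`H`. Infinitely many disjoint events of equal probability are null; this gives recurrence: almost
surely each element of `H` stays in `H` after conjugation moving a given point arbitrarily far away,
and one fixed point entails infinitely many. Hence `H` contains enough 3-cycles for every
transposition inside a class to normalize `H`, even when it is not in `H`. Moreover all classes are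
infinite, so a normalizing finite permutation, which fixes some point of each class, maps each class
to itself. Thus `g` normalizes `H` exactly when every cycle of `g` lies in one class
(`RecurrentSubgroup.smul_eq_iff`).

Ergodicity makes events on disjoint finite sets independent (`measureReal_inter_of_disjoint`), by
averaging over distant copies of one of them. So the character is a product over the cycles of `g`
of the numbers `p_k`, the probability that `k` points share a class (`adCharacter_eq_prod`), and
only the `p_k` with `k ≥ 2` matter for congruence. A second moment estimate produces subgroups whose
class frequencies below `N` have power sums close to the `p_k`, and compactness gives a sequence `a`
with `p_k = ∑ a_i ^ k` (`exists_hasSum_pow_classProb`). As classes are almost surely infinite, no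
mass is lost in the limit: `∑ a_i = 1` (`one_le_tsum_of_hasSum_classProb`). The `p_k` do not record
signs, so the parameter that carries `a` on the positive integers and vanishes elsewhere has the
same character. -/

noncomputable section

/-! ### Transpositions and extension of finite injections -/

namespace SInf

theorem ext_apply {g h : SInf} (H : ∀ n, g.1 n = h.1 n) : g = h :=
  Subtype.ext (Equiv.ext H)

instance : Countable SInf := by
  let φ : SInf → (ℕ →₀ ℤ) := fun g => Finsupp.ofSupportFinite (fun n => (g.1 n : ℤ) - n) (by
    refine Set.Finite.subset g.2 ?_
    intro n hn h
    rw [Function.mem_support] at hn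
    exact hn (by rw [h]; ring))
  refine Function.Injective.countable (f := φ) ?_
  intro g h hgh
  refine ext_apply fun n => ?_
  have := DFunLike.congr_fun hgh n
  simp only [φ, Finsupp.ofSupportFinite_coe] at this
  omega

/-- The transposition of `a` and `b`. -/
def tr (a b : ℕ) : SInf :=
  ⟨Equiv.swap a b, Set.Finite.subset (Set.toFinite {a, b}) (by
    intro n hn
    by_contra h
    simp only [Set.mem_insert_iff, Set.mem_singleton_iff, not_or] at h
    exact hn (Equiv.swap_apply_of_ne_of_ne h.1 h.2))⟩

theorem tr_apply (a b n : ℕ) : (tr a b).1 n = if n = a then b else if n = b then a else n :=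
  Equiv.swap_apply_def a b n

theorem tr_of_ne {a b n : ℕ} (ha : n ≠ a) (hb : n ≠ b) : (tr a b).1 n = n :=
  Equiv.swap_apply_of_ne_of_ne ha hb

theorem tr_left (a b : ℕ) : (tr a b).1 a = b := Equiv.swap_apply_left a b

theorem tr_right (a b : ℕ) : (tr a b).1 b = a := Equiv.swap_apply_right a b

theorem tr_mul_self (a b : ℕ) : tr a b * tr a b = 1 :=
  ext_apply fun n => by
    change Equiv.swap a b (Equiv.swap a b n) = n
    simp

theorem tr_inv (a b : ℕ) : (tr a b)⁻¹ = tr a b :=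
  inv_eq_of_mul_eq_one_right (tr_mul_self a b)

theorem mul_apply (g h : SInf) (n : ℕ) : (g * h).1 n = g.1 (h.1 n) := rfl

theorem inv_apply_eq {g : SInf} {n m : ℕ} : (g⁻¹).1 n = m ↔ n = g.1 m :=
  Equiv.Perm.inv_eq_iff_eq

@[simp] theorem apply_inv_self (g : SInf) (n : ℕ) : g.1 ((g⁻¹).1 n) = n :=
  g.1.apply_symm_apply n

@[simp] theorem inv_apply_self (g : SInf) (n : ℕ) : (g⁻¹).1 (g.1 n) = n :=
  g.1.symm_apply_apply n

/-- An injective map on a finite set of natural numbers extends to a finite permutation. -/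
theorem exists_extend (s : Finset ℕ) (e : ℕ → ℕ) (he : Set.InjOn e s) :
    ∃ σ : SInf, ∀ n ∈ s, σ.1 n = e n := by
  classical
  induction s using Finset.induction_on with
  | empty => exact ⟨1, by simp⟩
  | insert a s ha ih =>
    obtain ⟨σ, hσ⟩ := ih (he.mono (by simp))
    -- The transposition repairs the value at `a` and leaves the values on `s` alone, since neither
    -- `σ a` nor `e a` is among them.
    refine ⟨tr (σ.1 a) (e a) * σ, ?_⟩
    intro n hn
    rw [Finset.mem_insert] at hn
    rcases hn with rfl | hn
    · rw [mul_apply, tr_left]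
    · have hna : n ≠ a := fun h => ha (h ▸ hn)
      rw [mul_apply, tr_of_ne, hσ n hn]
      · exact fun h => hna (σ.1.injective h)
      · rw [hσ n hn]
        exact fun h => hna (he (by simp [hn]) (by simp) h)

end SInf

/-! ### Borel structure and adjoint action on the subgroup lattice -/

section Measurability

variable {G : Type*} [Group G]

theorem measurableSet_subgroup_mem (g : G) : MeasurableSet {H : Subgroup G | g ∈ H} := by
  classical
  have hc : Continuous (subgroupIndicator : Subgroup G → G → Bool) := continuous_induced_dom
  have h1 : Continuous fun H : Subgroup G => subgroupIndicator H g :=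
    (continuous_apply g).comp hc
  have h2 := h1.measurable (MeasurableSet.singleton true)
  convert h2 using 1
  ext H
  simp [subgroupIndicator]

/-- Countability of `G` makes the Borel σ-algebra of `{0,1}^G` the product σ-algebra, so coordinates
suffice. -/
theorem measurable_subgroup_of_mem [Countable G] {X : Type*} [MeasurableSpace X]
    {f : X → Subgroup G} (hf : ∀ g, MeasurableSet {x | g ∈ f x}) : Measurable f := by
  classical
  have h : (subgroupLatticeMeasurableSpace : MeasurableSpace (Subgroup G)) =
      MeasurableSpace.comap subgroupIndicator (inferInstance : MeasurableSpace (G → Bool)) := by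
    change borel (Subgroup G) = _
    rw [BorelSpace.measurable_eq (α := G → Bool), borel_comap]
  rw [h]
  refine Measurable.of_comap_le ?_ |>.mono le_rfl le_rfl
  rw [MeasurableSpace.comap_comp, ← measurable_iff_comap_le]
  refine measurable_pi_iff.2 fun g => ?_
  refine measurable_to_bool ?_
  convert hf g using 1
  ext x
  simp [subgroupIndicator]

theorem mem_toConjAct_smul (g h : G) (H : Subgroup G) :
    h ∈ ConjAct.toConjAct g • H ↔ g⁻¹ * h * g ∈ H := by
  rw [Subgroup.mem_pointwise_smul_iff_inv_smul_mem, ← map_inv, ConjAct.smul_def]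
  simp

theorem smul_eq_iff_mem_normalizer (g : G) (H : Subgroup G) :
    ConjAct.toConjAct g • H = H ↔ ∀ h, h ∈ H ↔ g⁻¹ * h * g ∈ H := by
  rw [SetLike.ext_iff]
  simp only [mem_toConjAct_smul]
  exact forall_congr' fun h => iff_comm

instance [Countable G] : MeasurableConstSMul (ConjAct G) (Subgroup G) where
  measurable_const_smul c := by
    refine measurable_subgroup_of_mem fun h => ?_
    have := measurableSet_subgroup_mem ((ConjAct.ofConjAct c)⁻¹ * h * ConjAct.ofConjAct c)
    convert this using 1
    ext H
    exact mem_toConjAct_smul (ConjAct.ofConjAct c) h H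

end Measurability

/-! ### Orbits and the common set of fixed points -/

section Classes

/-- Two points are equivalent if they lie in the same orbit of `H`, or are both fixed by `H`. -/
def orbitClass (H : Subgroup SInf) : Setoid ℕ where
  r n m := (∃ h ∈ H, h.1 n = m) ∨ ((∀ h ∈ H, h.1 n = n) ∧ ∀ h ∈ H, h.1 m = m)
  iseqv := by
    refine ⟨fun n => Or.inl ⟨1, H.one_mem, rfl⟩, ?_, ?_⟩
    · rintro n m (⟨h, hh, rfl⟩ | ⟨h1, h2⟩)
      · exact Or.inl ⟨h⁻¹, H.inv_mem hh, by simp⟩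
      · exact Or.inr ⟨h2, h1⟩
    · rintro n m k (⟨h, hh, rfl⟩ | ⟨h1, h2⟩) (⟨h', hh', rfl⟩ | ⟨h3, h4⟩)
      · exact Or.inl ⟨h' * h, H.mul_mem hh' hh, rfl⟩
      · refine Or.inr ⟨fun g hg => ?_, h4⟩
        have : h.1 n = n := by
          have := h3 h hh
          exact h.1.injective this
        rw [this] at h3
        exact h3 g hg
      · rw [h2 h' hh']
        exact Or.inr ⟨h1, h2⟩
      · exact Or.inr ⟨h1, h4⟩

theorem orbitClass_iff {H : Subgroup SInf} {n m : ℕ} : orbitClass H n m ↔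
    (∃ h ∈ H, h.1 n = m) ∨ ((∀ h ∈ H, h.1 n = n) ∧ ∀ h ∈ H, h.1 m = m) := Iff.rfl

theorem forall_mem_smul_iff (g : SInf) (H : Subgroup SInf) (n : ℕ) :
    (∀ h ∈ ConjAct.toConjAct g • H, h.1 (g.1 n) = g.1 n) ↔ ∀ h ∈ H, h.1 n = n := by
  constructor
  · intro h k hk
    have := h (g * k * g⁻¹) (by rw [mem_toConjAct_smul]; simpa [mul_assoc] using hk)
    simpa using this
  · intro h k hk
    rw [mem_toConjAct_smul] at hk
    have := h _ hk
    rwa [SInf.mul_apply, SInf.mul_apply, SInf.inv_apply_eq] at this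

theorem orbitClass_smul (g : SInf) (H : Subgroup SInf) (n m : ℕ) :
    orbitClass (ConjAct.toConjAct g • H) (g.1 n) (g.1 m) ↔ orbitClass H n m := by
  rw [orbitClass_iff, orbitClass_iff, forall_mem_smul_iff, forall_mem_smul_iff]
  refine or_congr_left ⟨?_, ?_⟩
  · rintro ⟨h, hh, h1⟩
    rw [mem_toConjAct_smul] at hh
    exact ⟨_, hh, by rw [SInf.mul_apply, SInf.mul_apply, h1, SInf.inv_apply_self]⟩
  · rintro ⟨h, hh, rfl⟩
    refine ⟨g * h * g⁻¹, by rw [mem_toConjAct_smul]; simpa [mul_assoc] using hh, ?_⟩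
    simp

theorem measurableSet_forall_fixed (n : ℕ) :
    MeasurableSet {H : Subgroup SInf | ∀ h ∈ H, h.1 n = n} := by
  simp only [Set.ofPred_forall]
  refine MeasurableSet.iInter fun h => ?_
  by_cases hn : h.1 n = n
  · simp [hn]
  · simp only [hn, imp_false]
    exact (measurableSet_subgroup_mem h).compl

theorem measurableSet_orbitClass (n m : ℕ) :
    MeasurableSet {H : Subgroup SInf | orbitClass H n m} := by
  refine MeasurableSet.union ?_ ((measurableSet_forall_fixed n).inter (measurableSet_forall_fixed m))
  have : {H : Subgroup SInf | ∃ h ∈ H, h.1 n = m} = ⋃ h : SInf, {H | h ∈ H ∧ h.1 n = m} := by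
    ext; simp
  change MeasurableSet {H : Subgroup SInf | ∃ h ∈ H, h.1 n = m}
  rw [this]
  refine MeasurableSet.iUnion fun h => ?_
  by_cases hn : h.1 n = m
  · simpa only [hn, and_true] using measurableSet_subgroup_mem h
  · simp [hn]

end Classes

/-! ### Measurability and equivariance of the signed Young subgroup -/

section YoungSubgroup

/-- The elements of the factors of the signed Young subgroup of `η(ξ)`. -/
def youngGenerators (ξ : ℕ → ℤ) : Set SInf :=
  {h | ∃ i, (0 < i ∧ h ∈ SInf.symOn (levelBlock ξ i)) ∨ (i < 0 ∧ h ∈ SInf.altOn (levelBlock ξ i))}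

theorem SInf.mem_symOn {B : Set ℕ} {h : SInf} : h ∈ SInf.symOn B ↔ ∀ n, n ∉ B → h.1 n = n :=
  Iff.rfl

theorem SInf.mem_altOn {B : Set ℕ} {h : SInf} :
    h ∈ SInf.altOn B ↔ (∀ n, n ∉ B → h.1 n = n) ∧ SInf.sign h = 1 := Iff.rfl

theorem SInf.eq_one_of_mem_symOn {B : Set ℕ} (hB : ¬ B.Nontrivial) {h : SInf}
    (hh : h ∈ SInf.symOn B) : h = 1 := by
  rw [Set.not_nontrivial_iff] at hB
  refine SInf.ext_apply fun n => ?_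
  change h.1 n = n
  by_cases hn : n ∈ B
  · by_cases hn' : h.1 n ∈ B
    · exact hB hn' hn
    · exact h.1.injective (hh _ hn')
  · exact hh n hn

/-- Blocks with at most one point contribute the trivial group, so the nontriviality condition can
be dropped. What remains is indexed by labels instead of blocks, which suits measurability. -/
theorem youngSubgroup_eq_closure (ξ : ℕ → ℤ) :
    (signedPartitionOf ξ).youngSubgroup = Subgroup.closure (youngGenerators ξ) := by
  apply le_antisymm
  · refine sup_le (iSup₂_le ?_) (iSup₂_le ?_)
    · rintro B ⟨i, hi, rfl, _⟩ h hh
      exact Subgroup.subset_closure ⟨i, Or.inl ⟨hi, hh⟩⟩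
    · rintro B ⟨i, hi, rfl, _⟩ h hh
      exact Subgroup.subset_closure ⟨i, Or.inr ⟨hi, hh⟩⟩
  · rw [Subgroup.closure_le]
    rintro h ⟨i, hh⟩
    by_cases hB : (levelBlock ξ i).Nontrivial
    · rcases hh with ⟨hi, hh⟩ | ⟨hi, hh⟩
      · exact (le_sup_of_le_left (le_iSup₂_of_le (levelBlock ξ i) ⟨i, hi, rfl, hB⟩ le_rfl) :
          SInf.symOn (levelBlock ξ i) ≤ _) hh
      · exact (le_sup_of_le_right (le_iSup₂_of_le (levelBlock ξ i) ⟨i, hi, rfl, hB⟩ le_rfl) :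
          SInf.altOn (levelBlock ξ i) ≤ _) hh
    · have : h = 1 := SInf.eq_one_of_mem_symOn hB
        (hh.elim (fun hh => hh.2) (fun hh => hh.2.1))
      rw [this]
      exact Subgroup.one_mem _

theorem inv_mem_youngGenerators {ξ : ℕ → ℤ} {h : SInf} (hh : h ∈ youngGenerators ξ) :
    h⁻¹ ∈ youngGenerators ξ := by
  obtain ⟨i, ⟨hi, hh⟩ | ⟨hi, hh⟩⟩ := hh
  · exact ⟨i, Or.inl ⟨hi, Subgroup.inv_mem _ hh⟩⟩
  · exact ⟨i, Or.inr ⟨hi, Subgroup.inv_mem _ hh⟩⟩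

/-- Writing membership through words over a countable group turns it into a countable union of
events. -/
theorem mem_youngSubgroup_iff_exists_list {ξ : ℕ → ℤ} {g : SInf} :
    g ∈ (signedPartitionOf ξ).youngSubgroup ↔
      ∃ l : List SInf, l.prod = g ∧ ∀ h ∈ l, h ∈ youngGenerators ξ := by
  rw [youngSubgroup_eq_closure]
  constructor
  · intro hg
    rw [← Subgroup.mem_toSubmonoid, Subgroup.closure_toSubmonoid] at hg
    obtain ⟨l, hl, hg⟩ := Submonoid.exists_list_of_mem_closure hg
    refine ⟨l, hg, fun h hh => (hl h hh).elim id fun h' => ?_⟩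
    simpa using inv_mem_youngGenerators h'
  · rintro ⟨l, rfl, hl⟩
    exact Subgroup.list_prod_mem _ fun h hh => Subgroup.subset_closure (hl h hh)

theorem measurableSet_mem_youngGenerators (h : SInf) :
    MeasurableSet {ξ : ℕ → ℤ | h ∈ youngGenerators ξ} := by
  have h1 : ∀ i : ℤ, MeasurableSet {ξ : ℕ → ℤ | h ∈ SInf.symOn (levelBlock ξ i)} := by
    intro i
    simp only [SInf.mem_symOn, Set.ofPred_forall]
    refine MeasurableSet.iInter fun n => ?_
    by_cases hn : h.1 n = n
    · simp [hn]
    · simp only [hn, imp_false, not_not]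
      exact measurable_pi_apply (X := fun _ : ℕ => ℤ) n (MeasurableSet.singleton i)
  have h2 : {ξ : ℕ → ℤ | h ∈ youngGenerators ξ} = ⋃ i : ℤ,
      {ξ : ℕ → ℤ | (0 < i ∨ i < 0 ∧ SInf.sign h = 1) ∧ h ∈ SInf.symOn (levelBlock ξ i)} := by
    ext ξ
    simp only [youngGenerators, Set.mem_ofPred_eq, Set.mem_iUnion, SInf.mem_altOn, SInf.mem_symOn]
    exact exists_congr fun i => by tauto
  rw [h2]
  refine MeasurableSet.iUnion fun i => ?_
  by_cases hi : 0 < i ∨ i < 0 ∧ SInf.sign h = 1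
  · simpa only [hi, true_and] using h1 i
  · simp [hi]

theorem measurable_youngSubgroup :
    Measurable fun ξ : ℕ → ℤ => (signedPartitionOf ξ).youngSubgroup := by
  refine measurable_subgroup_of_mem fun g => ?_
  have : {ξ : ℕ → ℤ | g ∈ (signedPartitionOf ξ).youngSubgroup} =
      ⋃ l : List SInf, {ξ | l.prod = g ∧ ∀ h ∈ l, h ∈ youngGenerators ξ} := by
    ext ξ
    simp only [mem_youngSubgroup_iff_exists_list, Set.mem_ofPred_eq, Set.mem_iUnion]
  rw [this]
  refine MeasurableSet.iUnion fun l => ?_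
  by_cases hl : l.prod = g
  · simp only [hl, true_and, Set.ofPred_forall]
    exact MeasurableSet.iInter fun h => MeasurableSet.iInter fun _ =>
      measurableSet_mem_youngGenerators h
  · simp [hl]

theorem mem_symOn_levelBlock_comp (g h : SInf) (ξ : ℕ → ℤ) (i : ℤ) :
    h ∈ SInf.symOn (levelBlock (ξ ∘ (g⁻¹).1) i) ↔ g⁻¹ * h * g ∈ SInf.symOn (levelBlock ξ i) := by
  simp only [SInf.mem_symOn, levelBlock, Set.mem_ofPred_eq, Function.comp]
  constructor
  · intro H n hn
    rw [SInf.mul_apply, SInf.mul_apply, SInf.inv_apply_eq]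
    exact H (g.1 n) (by simpa using hn)
  · intro H n hn
    have := H _ hn
    rw [SInf.mul_apply, SInf.mul_apply, SInf.inv_apply_eq] at this
    simpa using this

theorem youngSubgroup_comp (g : SInf) (ξ : ℕ → ℤ) :
    (signedPartitionOf (ξ ∘ (g⁻¹).1)).youngSubgroup =
      ConjAct.toConjAct g • (signedPartitionOf ξ).youngSubgroup := by
  rw [youngSubgroup_eq_closure, youngSubgroup_eq_closure, Subgroup.smul_closure]
  congr 1
  ext h
  rw [Set.mem_smul_set_iff_inv_smul_mem, ← map_inv, ConjAct.smul_def, ConjAct.ofConjAct_toConjAct,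
    inv_inv]
  refine exists_congr fun i => ?_
  have hs : SInf.sign (g⁻¹ * h * g) = SInf.sign h := by
    rw [map_mul, map_mul, mul_right_comm, ← map_mul, inv_mul_cancel, map_one, one_mul]
  rw [SInf.mem_altOn, SInf.mem_altOn, ← SInf.mem_symOn, ← SInf.mem_symOn, hs,
    mem_symOn_levelBlock_comp]

end YoungSubgroup

/-! ### Exchangeability and the zero-one law for product measures -/

section Bernoulli

open scoped symmDiff

variable {X : Type*} [MeasurableSpace X] (ρ : Measure X) [IsProbabilityMeasure ρ]

theorem measurePreserving_infinitePi_comp (g : Equiv.Perm ℕ) :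
    MeasurePreserving (fun ξ : ℕ → X => ξ ∘ g) (Measure.infinitePi fun _ : ℕ => ρ)
      (Measure.infinitePi fun _ : ℕ => ρ) := by
  have hm : Measurable fun ξ : ℕ → X => ξ ∘ g :=
    measurable_pi_iff.2 fun n => measurable_pi_apply (g n)
  refine ⟨hm, Measure.eq_infinitePi _ fun s t ht => ?_⟩
  rw [Measure.map_apply hm (MeasurableSet.pi s.countable_toSet fun i _ => ht i)]
  have : (fun ξ : ℕ → X => ξ ∘ g) ⁻¹' (Set.pi s t) =
      Set.pi (s.map g.toEmbedding) fun n => t (g.symm n) := by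
    ext ξ
    simp only [Set.mem_preimage, Set.mem_pi, Function.comp, Finset.coe_map, Set.forall_mem_image,
      Equiv.coe_toEmbedding, Equiv.symm_apply_apply]
  rw [this, Measure.infinitePi_pi _ fun i _ => ht _, Finset.prod_map]
  simp

/-- The moved cylinder depends on the coordinates in `g F`, disjoint from `F`: the two events are
independent and equally likely. -/
theorem measureReal_cylinder_inter_comp {F : Finset ℕ} {S : Set (F → X)} (hS : MeasurableSet S)
    (g : Equiv.Perm ℕ) (hg : ∀ n ∈ F, g n ∉ F) :
    (Measure.infinitePi fun _ : ℕ => ρ).real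
      (cylinder F S ∩ (fun ξ : ℕ → X => ξ ∘ g) ⁻¹' cylinder F S) =
    (Measure.infinitePi fun _ : ℕ => ρ).real (cylinder F S) ^ 2 := by
  have hd : Disjoint F (F.map g.toEmbedding) := by
    rw [Finset.disjoint_left]
    intro n hn hn'
    obtain ⟨m, hm, rfl⟩ := Finset.mem_map.1 hn'
    exact hg m hm hn
  have hI := (ProbabilityTheory.iIndepFun_infinitePi (P := fun _ : ℕ => ρ)
    (X := fun _ x => x) fun _ => measurable_id).indepFun_finset F (F.map g.toEmbedding) hd
    fun i => measurable_pi_apply i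
  let T : (((F.map g.toEmbedding : Finset ℕ)) → X) → (F → X) := fun x i =>
    x ⟨g i.1, Finset.mem_map_of_mem g.toEmbedding i.2⟩
  have hT : Measurable T := measurable_pi_iff.2 fun i => measurable_pi_apply _
  have h1 := hI.measure_inter_preimage_eq_mul S (T ⁻¹' S) hS (hT hS)
  have h2 : (fun ξ : ℕ → X => ξ ∘ g) ⁻¹' cylinder F S =
    (fun (ξ : ℕ → X) (i : (F.map g.toEmbedding : Finset ℕ)) => ξ i) ⁻¹' (T ⁻¹' S) := rfl
  have h3 : cylinder F S = (fun (ξ : ℕ → X) (i : F) => ξ i) ⁻¹' S := rfl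
  have h4 := (measurePreserving_infinitePi_comp ρ g).measure_preimage
    (MeasurableSet.cylinder (α := fun _ : ℕ => X) F hS).nullMeasurableSet
  rw [h2] at h4
  rw [← h3, h4] at h1
  rw [measureReal_def, h2, h1, ENNReal.toReal_mul, sq, measureReal_def]

theorem exists_perm_disjoint (F : Finset ℕ) : ∃ g : SInf, ∀ n ∈ F, g.1 n ∉ F := by
  obtain ⟨g, hg⟩ := SInf.exists_extend F (fun n => n + (F.sup id + 1))
    fun a _ b _ h => by simpa using h
  refine ⟨g, fun n hn h => ?_⟩
  rw [hg n hn] at h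
  have := Finset.le_sup (f := id) h
  simp only [id] at this
  omega

/-- The **Hewitt–Savage zero-one law**. -/
theorem measureReal_eq_sq_of_exchangeable {s : Set (ℕ → X)} (hs : MeasurableSet s)
    (h : ∀ g : SInf, (fun ξ : ℕ → X => ξ ∘ g.1) ⁻¹' s =ᵐ[Measure.infinitePi fun _ : ℕ => ρ] s) :
    (Measure.infinitePi fun _ : ℕ => ρ).real s =
      (Measure.infinitePi fun _ : ℕ => ρ).real s ^ 2 := by
  set μ := Measure.infinitePi fun _ : ℕ => ρ with hμ
  -- If a cylinder `A` is within `ε` of `s`, then `A ∩ B`, of measure `μ(A) ^ 2`, is within `2ε` of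
  -- `s`, and `μ(A) ^ 2` is within `2ε` of `μ(s) ^ 2`.
  have key : ∀ ε > 0, |μ.real s - μ.real s ^ 2| ≤ 4 * ε := by
    intro ε hε
    have hd := Measure.MeasureDense.of_generateFrom_isSetAlgebra_finite μ
      isSetAlgebra_measurableCylinders (generateFrom_measurableCylinders (α := fun _ : ℕ => X)).symm
    obtain ⟨A, hA, hsA⟩ := hd.approx s hs (measure_ne_top _ _) ε hε
    obtain ⟨F, S, hS, rfl⟩ := (mem_measurableCylinders _).1 hA
    have hsA' : μ.real (s ∆ cylinder F S) ≤ ε :=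
      ENNReal.toReal_le_of_le_ofReal hε.le hsA.le
    obtain ⟨g, hg⟩ := exists_perm_disjoint F
    have hc : MeasurableSet (cylinder F S) := hd.measurable _ hA
    let B := (fun ξ : ℕ → X => ξ ∘ g.1) ⁻¹' cylinder F S
    have hBm : MeasurableSet B := (measurePreserving_infinitePi_comp ρ g.1).measurable hc
    have h1 : μ.real (cylinder F S ∩ B) = μ.real (cylinder F S) ^ 2 :=
      measureReal_cylinder_inter_comp ρ hS g.1 hg
    have h2 : μ.real (s ∆ B) ≤ ε := by
      have e1 : μ.real (s ∆ B) = μ.real (((fun ξ : ℕ → X => ξ ∘ g.1) ⁻¹' s) ∆ B) :=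
        measureReal_congr ((h g).symm.symmDiff (ae_eq_refl B))
      rw [e1, ← Set.preimage_symmDiff, measureReal_def,
        (measurePreserving_infinitePi_comp ρ g.1).measure_preimage
          (hs.symmDiff hc).nullMeasurableSet]
      exact hsA'
    have h3 : μ.real (s ∆ (cylinder F S ∩ B)) ≤ 2 * ε := by
      have : s ∆ (cylinder F S ∩ B) ⊆ s ∆ cylinder F S ∪ s ∆ B := by
        intro x
        simp only [Set.mem_symmDiff, Set.mem_union, Set.mem_inter_iff]
        tauto
      linarith [measureReal_mono (μ := μ) this, measureReal_union_le (μ := μ) (s ∆ cylinder F S) (s ∆ B)]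
    have h4 := (abs_measureReal_sub_le_measureReal_symmDiff hs.nullMeasurableSet
      (hc.inter hBm).nullMeasurableSet).trans h3
    have h5 := (abs_measureReal_sub_le_measureReal_symmDiff hs.nullMeasurableSet
      hc.nullMeasurableSet).trans hsA'
    rw [h1] at h4
    have h6 : |μ.real (cylinder F S) ^ 2 - μ.real s ^ 2| ≤ 2 * ε := by
      have ha : μ.real (cylinder F S) ≤ 1 := measureReal_le_one
      have hb : μ.real s ≤ 1 := measureReal_le_one
      have ha' : 0 ≤ μ.real (cylinder F S) := measureReal_nonneg
      have hb' : 0 ≤ μ.real s := measureReal_nonneg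
      rw [sq_sub_sq, abs_mul, abs_sub_comm, abs_of_nonneg (add_nonneg ha' hb')]
      have := abs_nonneg (μ.real s - μ.real (cylinder F S))
      nlinarith
    calc |μ.real s - μ.real s ^ 2| ≤ |μ.real s - μ.real (cylinder F S) ^ 2| +
          |μ.real (cylinder F S) ^ 2 - μ.real s ^ 2| := abs_sub_le _ _ _
      _ ≤ 4 * ε := by linarith
  have : |μ.real s - μ.real s ^ 2| ≤ 0 := by
    refine le_of_forall_pos_le_add fun ε hε => ?_
    have := key (ε / 4) (by positivity)
    linarith
  exact sub_eq_zero.1 (abs_eq_zero.1 (le_antisymm this (abs_nonneg _)))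

end Bernoulli

/-! ### Invariance and ergodicity of `ν_α` -/

namespace ThomaParameter

variable (α : ThomaParameter)

instance : IsProbabilityMeasure α.pmf.toMeasure := PMF.toMeasure.isProbabilityMeasure _

instance : IsProbabilityMeasure α.bernoulli := by
  unfold bernoulli; infer_instance

instance : IsProbabilityMeasure α.nu :=
  Measure.isProbabilityMeasure_map measurable_youngSubgroup.aemeasurable

theorem toConjAct_smul_comp_youngSubgroup (g : SInf) :
    (fun H : Subgroup SInf => ConjAct.toConjAct g • H) ∘
      (fun ξ : ℕ → ℤ => (signedPartitionOf ξ).youngSubgroup) =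
    (fun ξ : ℕ → ℤ => (signedPartitionOf ξ).youngSubgroup) ∘ fun ξ => ξ ∘ (g⁻¹).1 :=
  funext fun ξ => (youngSubgroup_comp g ξ).symm

/-- The law of the random signed Young subgroup is invariant and ergodic. -/
theorem isErgodicADMeasure_nu : IsErgodicADMeasure α.nu := by
  refine ⟨inferInstance, { toSMulInvariantMeasure := ⟨?_⟩, aeconst_of_forall_preimage_smul_ae_eq := ?_ }⟩
  · intro c s hs
    have hc := toConjAct_smul_comp_youngSubgroup (ConjAct.ofConjAct c)
    rw [ConjAct.toConjAct_ofConjAct] at hc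
    have hsm : MeasurableSet ((fun H : Subgroup SInf => c • H) ⁻¹' s) :=
      measurable_const_smul c hs
    rw [nu, Measure.map_apply measurable_youngSubgroup hs,
      Measure.map_apply measurable_youngSubgroup hsm, ← Set.preimage_comp, hc, Set.preimage_comp]
    exact (measurePreserving_infinitePi_comp α.pmf.toMeasure _).measure_preimage
      (measurable_youngSubgroup hs).nullMeasurableSet
  · intro s hs h
    set Y := fun ξ : ℕ → ℤ => (signedPartitionOf ξ).youngSubgroup with hY
    have h1 : α.bernoulli.real (Y ⁻¹' s) = α.bernoulli.real (Y ⁻¹' s) ^ 2 := by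
      refine measureReal_eq_sq_of_exchangeable α.pmf.toMeasure (measurable_youngSubgroup hs)
        fun g => ?_
      have hg := (measurable_youngSubgroup.quasiMeasurePreserving α.bernoulli).preimage_ae_eq
        (h (ConjAct.toConjAct g⁻¹))
      rw [← Set.preimage_comp, toConjAct_smul_comp_youngSubgroup, Set.preimage_comp, inv_inv] at hg
      exact hg
    have h2 : α.nu.real s = α.bernoulli.real (Y ⁻¹' s) := by
      rw [measureReal_def, nu, Measure.map_apply measurable_youngSubgroup hs, measureReal_def]
    rw [← h2] at h1
    rw [Filter.eventuallyConst_set']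
    have h3 : α.nu.real s = 0 ∨ α.nu.real s = 1 := by
      rcases eq_or_ne (α.nu.real s) 0 with h0 | h0
      · exact Or.inl h0
      · right
        have : α.nu.real s * (α.nu.real s - 1) = 0 := by linarith
        rcases mul_eq_zero.1 this with h | h
        · exact absurd h h0
        · linarith
    rcases h3 with h3 | h3
    · left
      rw [measureReal_eq_zero_iff] at h3
      exact ae_eq_empty.2 h3
    · right
      rw [ae_eq_univ, ← measureReal_eq_zero_iff, probReal_compl_eq_one_sub hs, h3, sub_self]

end ThomaParameter

/-! ### Averages of vectors with a two-valued Gram matrix -/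

section Gram

open Filter Topology

variable {E : Type*} [NormedAddCommGroup E] [InnerProductSpace ℝ E]

/-- The average of the first `n` terms of a sequence of vectors. -/
def avg (v : ℕ → E) (n : ℕ) : E := (n : ℝ)⁻¹ • ∑ k ∈ Finset.range n, v k

/-- Each row `j < m ≤ n` has exactly one diagonal entry among its first `n`, so all row sums agree
and `m` drops out. -/
theorem inner_avg_avg_of_gram {v : ℕ → E} {c d : ℝ} (hd : ∀ k, inner ℝ (v k) (v k) = d)
    (hc : ∀ j k, j ≠ k → inner ℝ (v j) (v k) = c) {m n : ℕ} (hm : 0 < m) (hmn : m ≤ n) :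
    inner ℝ (avg v m) (avg v n) = c + (d - c) / n := by
  have h1 : ∀ j ∈ Finset.range m, ∑ k ∈ Finset.range n, inner ℝ (v j) (v k) = n * c + (d - c) := by
    intro j hj
    have hj' : j ∈ Finset.range n :=
      Finset.mem_range.2 ((Finset.mem_range.1 hj).trans_le hmn)
    have : ∀ k ∈ Finset.range n, inner ℝ (v j) (v k) = c + if j = k then d - c else 0 := by
      intro k _
      split_ifs with h
      · rw [← h, hd]; ring
      · rw [hc j k h]; ring
    rw [Finset.sum_congr rfl this, Finset.sum_add_distrib, Finset.sum_ite_eq, if_pos hj']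
    simp
  have hm' : (m : ℝ) ≠ 0 := by positivity
  have hn' : (n : ℝ) ≠ 0 := by have := hm.trans_le hmn; positivity
  rw [avg, avg, real_inner_smul_left, real_inner_smul_right, sum_inner]
  simp only [inner_sum]
  rw [Finset.sum_congr rfl h1, Finset.sum_const, Finset.card_range, nsmul_eq_mul]
  field_simp

/-- The squared distance of the averages of length `N ≤ n` is `(d - c) * (1/N - 1/n)`, so they form
a Cauchy sequence. -/
theorem exists_tendsto_avg_of_gram [CompleteSpace E] {v : ℕ → E} {c d : ℝ}
    (hd : ∀ k, inner ℝ (v k) (v k) = d) (hc : ∀ j k, j ≠ k → inner ℝ (v j) (v k) = c) :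
    ∃ φ, Tendsto (avg v) atTop (𝓝 φ) := by
  refine cauchySeq_tendsto_of_complete (Metric.cauchySeq_iff'.2 fun ε hε => ?_)
  obtain ⟨N, hN⟩ := exists_nat_gt (|d - c| / ε ^ 2)
  have hN0 : 0 < (N : ℝ) := lt_of_le_of_lt (by positivity) hN
  have hN0' : 0 < N := by exact_mod_cast hN0
  refine ⟨N, fun n hn => ?_⟩
  have h : ‖avg v N - avg v n‖ ^ 2 = (d - c) / N - (d - c) / n := by
    rw [@norm_sub_sq ℝ, ← real_inner_self_eq_norm_sq, ← real_inner_self_eq_norm_sq,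
      inner_avg_avg_of_gram hd hc hN0' le_rfl, inner_avg_avg_of_gram hd hc hN0' hn,
      inner_avg_avg_of_gram hd hc (hN0'.trans_le hn) le_rfl]
    simp only [RCLike.re_to_real]
    ring
  have hnN : (n : ℝ)⁻¹ ≤ (N : ℝ)⁻¹ := inv_anti₀ hN0 (by exact_mod_cast hn)
  have h2 : ‖avg v N - avg v n‖ ^ 2 < ε ^ 2 := by
    rw [h, div_eq_mul_inv, div_eq_mul_inv, ← mul_sub]
    calc (d - c) * ((N : ℝ)⁻¹ - (n : ℝ)⁻¹) ≤ |d - c| * ((N : ℝ)⁻¹ - (n : ℝ)⁻¹) :=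
          mul_le_mul_of_nonneg_right (le_abs_self _) (by linarith)
      _ ≤ |d - c| * (N : ℝ)⁻¹ := by
          have : 0 ≤ (n : ℝ)⁻¹ := by positivity
          exact mul_le_mul_of_nonneg_left (by linarith) (abs_nonneg _)
      _ < ε ^ 2 := by
          rw [← div_eq_mul_inv, div_lt_iff₀ hN0]
          rw [div_lt_iff₀ (by positivity)] at hN
          linarith
  rw [dist_comm, dist_eq_norm]
  exact lt_of_pow_lt_pow_left₀ 2 hε.le h2

end Gram

/-! ### Independence of events on disjoint sets, from ergodicity -/

section Ergodic

open Filter Topology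

/-- Ergodicity makes preimages of measurable sets null or conull, and countably many such sets
separate the values. -/
theorem exists_ae_eq_const_of_invariant {G X β : Type*} [SMul G X] [MeasurableSpace X]
    {μ : Measure X} [ErgodicSMul G X μ] [MeasurableSpace β] [Nonempty β]
    [HasCountableSeparatingOn β MeasurableSet Set.univ] {φ : X → β} (hφ : Measurable φ)
    (h : ∀ g : G, (fun x => φ (g • x)) =ᵐ[μ] φ) : ∃ c, φ =ᵐ[μ] Function.const X c := by
  refine exists_eventuallyEq_const_of_forall_separating MeasurableSet fun U hU => ?_
  have := ErgodicSMul.aeconst_of_forall_preimage_smul_ae_eq (G := G) (μ := μ) (hφ hU) fun g =>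
    (h g).mono fun x hx => by
      simp only at hx
      change (φ (g • x) ∈ U) = (φ x ∈ U)
      rw [hx]
  exact eventuallyConst_pred.1 this

variable {μ : Measure (Subgroup SInf)}

/-- If `σ`, `τ` and `σ'`, `τ'` send a finite set to disjoint sets, a finite permutation takes the
first pair to the second one. -/
theorem SInf.exists_mul_eq {s : Finset ℕ} {σ τ σ' τ' : SInf}
    (h : ∀ a ∈ s, ∀ b ∈ s, σ.1 a ≠ τ.1 b) (h' : ∀ a ∈ s, ∀ b ∈ s, σ'.1 a ≠ τ'.1 b) :
    ∃ ρ : SInf, ∀ n ∈ s, ρ.1 (σ.1 n) = σ'.1 n ∧ ρ.1 (τ.1 n) = τ'.1 n := by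
  classical
  have hτ : ∀ n ∈ s, (σ⁻¹).1 (τ.1 n) ∉ s := by
    intro n hn hmem
    exact h _ hmem n hn (by simp)
  -- This map sends `σ n` to `σ' n` and `τ n` to `τ' n` for `n ∈ s`; the first disjointness
  -- assumption makes it consistent, the second one injective there.
  let e : ℕ → ℕ := fun m => if (σ⁻¹).1 m ∈ s then σ'.1 ((σ⁻¹).1 m) else τ'.1 ((τ⁻¹).1 m)
  have e1 : ∀ n ∈ s, e (σ.1 n) = σ'.1 n := by
    intro n hn
    simp [e, hn]
  have e2 : ∀ n ∈ s, e (τ.1 n) = τ'.1 n := by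
    intro n hn
    simp only [e, if_neg (hτ n hn), SInf.inv_apply_self]
  obtain ⟨ρ, hρ⟩ := SInf.exists_extend (s.image σ.1 ∪ s.image τ.1) e (by
    intro x hx y hy hxy
    simp only [Finset.coe_union, Finset.coe_image, Set.mem_union, Set.mem_image,
      Finset.mem_coe] at hx hy
    obtain ⟨a, ha, rfl⟩ | ⟨a, ha, rfl⟩ := hx <;> obtain ⟨b, hb, rfl⟩ | ⟨b, hb, rfl⟩ := hy
    · rw [e1 a ha, e1 b hb] at hxy
      rw [σ'.1.injective hxy]
    · rw [e1 a ha, e2 b hb] at hxy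
      exact absurd hxy (h' a ha b hb)
    · rw [e2 a ha, e1 b hb] at hxy
      exact absurd hxy.symm (h' b hb a ha)
    · rw [e2 a ha, e2 b hb] at hxy
      rw [τ'.1.injective hxy])
  refine ⟨ρ, fun n hn => ⟨?_, ?_⟩⟩
  · rw [hρ _ (Finset.mem_union_left _ (Finset.mem_image_of_mem _ hn)), e1 n hn]
  · rw [hρ _ (Finset.mem_union_right _ (Finset.mem_image_of_mem _ hn)), e2 n hn]

/-- There are permutations that fix the points of `F` and send `F'` to pairwise disjoint sets
that leave every finite set. -/
theorem SInf.exists_disjoint_copies {F F' : Finset ℕ} (hF : Disjoint F F') :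
    ∃ σ : ℕ → SInf, (∀ k, ∀ n ∈ F, (σ k).1 n = n) ∧
      (∀ j k, j ≠ k → ∀ a ∈ F', ∀ b ∈ F', (σ j).1 a ≠ (σ k).1 b) ∧
      ∀ k, ∀ n ∈ F', k ≤ (σ k).1 n := by
  classical
  obtain ⟨M, hM⟩ : ∃ M, ∀ n ∈ F ∪ F', n < M :=
    ⟨(F ∪ F').sup id + 1, fun n hn => Nat.lt_succ_of_le (Finset.le_sup (f := id) hn)⟩
  let e : ℕ → ℕ → ℕ := fun k n => if n ∈ F then n else n + M * (k + 1)
  have he : ∀ k, Set.InjOn (e k) (F ∪ F' : Finset ℕ) := by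
    intro k a ha b hb hab
    have h1 := hM a ha
    have h2 := hM b hb
    have h3 : M ≤ M * (k + 1) := Nat.le_mul_of_pos_right _ (by omega)
    simp only [e] at hab
    split_ifs at hab <;> omega
  choose σ hσ using fun k => SInf.exists_extend _ (e k) (he k)
  have hσ' : ∀ k, ∀ n ∈ F', (σ k).1 n = n + M * (k + 1) := by
    intro k n hn
    rw [hσ k n (Finset.mem_union_right _ hn)]
    exact if_neg fun h => Finset.disjoint_left.1 hF h hn
  refine ⟨σ, fun k n hn => ?_, fun j k hjk a ha b hb hab => hjk ?_, fun k n hn => ?_⟩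
  · rw [hσ k n (Finset.mem_union_left _ hn)]
    exact if_pos hn
  · rw [hσ' j a ha, hσ' k b hb] at hab
    have h1 := hM a (Finset.mem_union_right _ ha)
    have h2 := hM b (Finset.mem_union_right _ hb)
    have h3 : (a + M * (j + 1)) / M = (b + M * (k + 1)) / M := by rw [hab]
    rw [Nat.add_mul_div_left _ _ (by omega), Nat.add_mul_div_left _ _ (by omega),
      Nat.div_eq_of_lt h1, Nat.div_eq_of_lt h2] at h3
    omega
  · rw [hσ' k n hn]
    have h1 := hM n (Finset.mem_union_right _ hn)
    have : 1 * (k + 1) ≤ M * (k + 1) := Nat.mul_le_mul_right _ (by omega)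
    omega

/-- The set `A` of subgroups is invariant under the permutations that fix all points of `F`. -/
def FixInvariant (A : Set (Subgroup SInf)) (F : Finset ℕ) : Prop :=
  ∀ g : SInf, (∀ n ∈ F, g.1 n = n) → ∀ H, ConjAct.toConjAct g • H ∈ A ↔ H ∈ A

/-- The conjTranslate `σ B`. -/
def conjTranslate (σ : SInf) (B : Set (Subgroup SInf)) : Set (Subgroup SInf) :=
  (fun H => ConjAct.toConjAct σ⁻¹ • H) ⁻¹' B

theorem measurableSet_conjTranslate (σ : SInf) {B : Set (Subgroup SInf)} (hB : MeasurableSet B) :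
    MeasurableSet (conjTranslate σ B) :=
  measurable_const_smul (ConjAct.toConjAct σ⁻¹) hB

theorem measureReal_conjTranslate [SMulInvariantMeasure (ConjAct SInf) (Subgroup SInf) μ]
    (σ : SInf) {B : Set (Subgroup SInf)} (hB : MeasurableSet B) :
    μ.real (conjTranslate σ B) = μ.real B := by
  rw [measureReal_def, measureReal_def]
  exact congrArg _ (SMulInvariantMeasure.measure_preimage_smul (ConjAct.toConjAct σ⁻¹) hB)

theorem FixInvariant.conjTranslate_eq {B : Set (Subgroup SInf)} {F : Finset ℕ} (hB : FixInvariant B F)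
    {ρ σ σ' : SInf} (h : ∀ n ∈ F, ρ.1 (σ.1 n) = σ'.1 n) :
    conjTranslate ρ (conjTranslate σ B) = conjTranslate σ' B := by
  ext H
  have h1 := hB (σ'⁻¹ * ρ * σ) (fun n hn => by
    rw [SInf.mul_apply, SInf.mul_apply, h n hn, SInf.inv_apply_self])
    (ConjAct.toConjAct σ⁻¹ • ConjAct.toConjAct ρ⁻¹ • H)
  change ConjAct.toConjAct σ⁻¹ • ConjAct.toConjAct ρ⁻¹ • H ∈ B ↔ ConjAct.toConjAct σ'⁻¹ • H ∈ B
  rw [← h1, smul_smul, smul_smul, ← ConjAct.toConjAct_mul, ← ConjAct.toConjAct_mul]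
  simp [mul_assoc]

/-- For an ergodic invariant measure, events that depend on disjoint finite sets are
independent. -/
theorem measureReal_inter_of_disjoint [IsProbabilityMeasure μ]
    [ErgodicSMul (ConjAct SInf) (Subgroup SInf) μ] {A B : Set (Subgroup SInf)}
    (hA : MeasurableSet A) (hB : MeasurableSet B) {F F' : Finset ℕ} (hF : Disjoint F F')
    (hAF : FixInvariant A F) (hBF : FixInvariant B F') :
    μ.real (A ∩ B) = μ.real A * μ.real B := by
  obtain ⟨σ, hσF, hσd, hσk⟩ := SInf.exists_disjoint_copies hF
  have hBm : ∀ k, MeasurableSet (conjTranslate (σ k) B) := fun k => measurableSet_conjTranslate _ hB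
  -- Any two distinct copies of `B` can be carried to any other two, so the Gram matrix of their
  -- indicators takes one value on and one off the diagonal. The averages then converge in `L²`.
  let v : ℕ → Lp ℝ 2 μ := fun k => indicatorConstLp 2 (hBm k) (measure_ne_top μ _) (1 : ℝ)
  have hd : ∀ k, inner ℝ (v k) (v k) = μ.real B := by
    intro k
    rw [L2.real_inner_indicatorConstLp_one_indicatorConstLp_one, Set.inter_self,
      measureReal_conjTranslate _ hB]
  have hc : ∀ j k, j ≠ k →
      inner ℝ (v j) (v k) = μ.real (conjTranslate (σ 0) B ∩ conjTranslate (σ 1) B) := by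
    intro j k hjk
    rw [L2.real_inner_indicatorConstLp_one_indicatorConstLp_one]
    obtain ⟨ρ, hρ⟩ := SInf.exists_mul_eq (hσd j k hjk) (hσd 0 1 (by norm_num))
    rw [← hBF.conjTranslate_eq fun n hn => (hρ n hn).1, ← hBF.conjTranslate_eq fun n hn => (hρ n hn).2]
    exact (measureReal_conjTranslate ρ ((hBm j).inter (hBm k))).symm
  obtain ⟨φ, hφ⟩ := exists_tendsto_avg_of_gram hd hc
  have hinner : ∀ {C : Set (Subgroup SInf)} (hC : MeasurableSet C) (t : ℝ),
      (∀ k, μ.real (C ∩ conjTranslate (σ k) B) = t) → ∫ x in C, φ x ∂μ = t := by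
    intro C hC t ht
    rw [← L2.inner_indicatorConstLp_one (𝕜 := ℝ) hC (measure_ne_top μ _) φ]
    refine tendsto_nhds_unique ((continuous_const.inner continuous_id).continuousAt.tendsto.comp hφ)
      (tendsto_const_nhds.congr' ?_)
    filter_upwards [eventually_gt_atTop 0] with n hn
    simp only [Function.comp, id, avg, real_inner_smul_right, inner_sum]
    rw [Finset.sum_congr rfl fun k _ => (L2.real_inner_indicatorConstLp_one_indicatorConstLp_one
      hC (hBm k)).trans (ht k)]
    have : (n : ℝ) ≠ 0 := by positivity
    simp [this]
  -- A finite permutation preserves all but finitely many copies, and averages forget finitely many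
  -- terms; the limit is thus invariant.
  have hinv : ∀ c : ConjAct SInf, (fun H : Subgroup SInf => φ (c • H)) =ᵐ[μ] φ := by
    intro c
    have hT : MeasurePreserving (fun H : Subgroup SInf => c • H) μ μ := measurePreserving_smul c μ
    let U := Lp.compMeasurePreservingₗᵢ ℝ (E := ℝ) (p := 2) _ hT
    have hev : ∀ᶠ k in atTop, U (v k) - v k = 0 := by
      obtain ⟨N, hN⟩ : ∃ N, ∀ n, (ConjAct.ofConjAct c).1 n ≠ n → n < N := by
        obtain ⟨N, hN⟩ := (ConjAct.ofConjAct c).moved.exists_nat_subset_range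
        exact ⟨N, fun n hn => Finset.mem_range.1 (hN ((SInf.mem_moved _ _).2 hn))⟩
      filter_upwards [eventually_ge_atTop N] with k hk
      have he : (fun H : Subgroup SInf => c • H) ⁻¹' conjTranslate (σ k) B = conjTranslate (σ k) B := by
        have := hBF.conjTranslate_eq (ρ := (ConjAct.ofConjAct c)⁻¹) (σ := σ k) (σ' := σ k)
          fun n hn => by
            rw [SInf.inv_apply_eq]
            by_contra hne
            exact absurd (hN _ (Ne.symm hne)) (not_lt.2 (hk.trans (hσk k n hn)))
        conv_rhs => rw [← this]
        rw [conjTranslate.eq_1 (ConjAct.ofConjAct c)⁻¹, inv_inv, ConjAct.toConjAct_ofConjAct]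
      rw [sub_eq_zero]
      change Lp.compMeasurePreserving _ hT (indicatorConstLp 2 (hBm k) _ (1 : ℝ)) = _
      rw [Lp.indicatorConstLp_compMeasurePreserving]
      congr 1
    have h1 : Tendsto (fun n : ℕ => avg (fun k => U (v k) - v k) n) atTop (𝓝 0) :=
      Filter.Tendsto.cesaro_smul ((tendsto_congr' hev).2 tendsto_const_nhds)
    have h2 : Tendsto (fun n : ℕ => avg (fun k => U (v k) - v k) n) atTop (𝓝 (U φ - φ)) := by
      refine Tendsto.congr ?_ (((U.continuous.tendsto φ).comp hφ).sub hφ)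
      intro n
      simp only [avg, Function.comp, map_smul, map_sum, Finset.sum_sub_distrib, smul_sub]
    have h3 : U φ = φ := sub_eq_zero.1 (tendsto_nhds_unique h2 h1)
    have h4 : (U φ : Subgroup SInf → ℝ) =ᵐ[μ] φ ∘ fun H => c • H :=
      Lp.coeFn_compMeasurePreserving φ hT
    rw [h3] at h4
    exact h4.symm
  obtain ⟨t, ht⟩ := exists_ae_eq_const_of_invariant (G := ConjAct SInf)
    (Lp.stronglyMeasurable φ).measurable hinv
  have hint : ∀ {C : Set (Subgroup SInf)}, MeasurableSet C →
      ∫ x in C, φ x ∂μ = μ.real C * t := by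
    intro C hC
    rw [setIntegral_congr_ae₀ (g := fun _ => t) hC.nullMeasurableSet (ht.mono fun x hx _ => hx)]
    simp
  -- Integration over the whole space identifies the constant as `μ(B)`. Integration over `A` gives
  -- `μ(A ∩ B)`, since `σ k` fixes `F` pointwise and so preserves `A`.
  have e1 := hinner MeasurableSet.univ (μ.real B) fun k => by
    rw [Set.univ_inter, measureReal_conjTranslate _ hB]
  have e2 := hinner hA (μ.real (A ∩ B)) fun k => by
    have hAk : conjTranslate (σ k) A = A := by
      ext H
      exact hAF (σ k)⁻¹ (fun n hn => by rw [SInf.inv_apply_eq, hσF k n hn]) H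
    calc μ.real (A ∩ conjTranslate (σ k) B)
        = μ.real (conjTranslate (σ k) A ∩ conjTranslate (σ k) B) := by rw [hAk]
      _ = μ.real (A ∩ B) := measureReal_conjTranslate (σ k) (hA.inter hB)
  rw [hint MeasurableSet.univ, probReal_univ, one_mul] at e1
  rw [← e2, hint hA, e1]

end Ergodic

/-! ### Recurrence for invariant measures -/

section Recurrence

theorem measure_eq_zero_of_pairwise_disjoint {Ω : Type*} [MeasurableSpace Ω] {μ : Measure Ω}
    [IsFiniteMeasure μ] {D : ℕ → Set Ω} (hD : ∀ k, MeasurableSet (D k))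
    (hd : Pairwise (Function.onFun Disjoint D)) (h : ∀ k, μ (D k) = μ (D 0)) : μ (D 0) = 0 := by
  by_contra h0
  have h1 : ∑' k, μ (D k) = ⊤ := by
    simp only [h]
    exact ENNReal.tsum_const_eq_top_of_ne_zero h0
  rw [← measure_iUnion hd hD] at h1
  exact measure_ne_top μ _ h1

variable {μ : Measure (Subgroup SInf)}

/-- A recurrence property: an event that depends on finitely many points recurs when one of them
is moved away. -/
theorem ae_recurrent [IsProbabilityMeasure μ] [SMulInvariantMeasure (ConjAct SInf) (Subgroup SInf) μ]
    {E : Set (Subgroup SInf)} (hE : MeasurableSet E) {F : Finset ℕ} (hEF : FixInvariant E F)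
    (n₀ : ℕ) : ∀ᵐ H ∂μ, H ∈ E → ∀ M, ∃ m, M ≤ m ∧ ConjAct.toConjAct (SInf.tr n₀ m) • H ∈ E := by
  have key : ∀ M : ℕ, ∀ᵐ H ∂μ, H ∈ E →
      ∃ m, M ≤ m ∧ ConjAct.toConjAct (SInf.tr n₀ m) • H ∈ E := by
    intro M
    obtain ⟨L, hL⟩ := F.exists_nat_subset_range
    -- Index `0` is `n₀` itself; all others are distinct new points, at least `M` and outside `F`.
    let f : ℕ → ℕ := fun j => if j = 0 then n₀ else M + L + n₀ + j
    have hf : Function.Injective f := by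
      intro i j hij
      simp only [f] at hij
      split_ifs at hij <;> omega
    have hf0 : f 0 = n₀ := if_pos rfl
    have hfF : ∀ n ∈ F, n ≠ n₀ → ∀ j, n ≠ f j := by
      intro n hn hn0 j
      have := Finset.mem_range.1 (hL hn)
      simp only [f]
      split_ifs <;> omega
    let Ek : ℕ → Set (Subgroup SInf) := fun j => conjTranslate (SInf.tr n₀ (f j)) E
    have hEk : ∀ j, MeasurableSet (Ek j) := fun j => measurableSet_conjTranslate _ hE
    have htr : ∀ k j, conjTranslate (SInf.tr n₀ (f k)) (Ek j) = Ek (Equiv.swap 0 k j) := by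
      intro k j
      refine hEF.conjTranslate_eq fun n hn => ?_
      by_cases hn0 : n = n₀
      · subst hn0
        rw [SInf.tr_left, SInf.tr_left]
        rcases eq_or_ne j 0 with rfl | hj0
        · rw [hf0, SInf.tr_left, Equiv.swap_apply_left]
        · rcases eq_or_ne j k with rfl | hjk
          · rw [SInf.tr_right, Equiv.swap_apply_right, hf0]
          · rw [Equiv.swap_apply_of_ne_of_ne hj0 hjk, SInf.tr_of_ne]
            · exact fun h => hj0 (hf (h.trans hf0.symm))
            · exact fun h => hjk (hf h)
      · rw [SInf.tr_of_ne hn0 (hfF n hn hn0 j), SInf.tr_of_ne hn0 (hfF n hn hn0 k),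
          SInf.tr_of_ne hn0 (hfF n hn hn0 _)]
    -- On `D k` only the `k`-th copy of `E` occurs. These events are disjoint and translates of each
    -- other, hence null, while failure to recur beyond `M` would put `H` in `D 0`.
    let D : ℕ → Set (Subgroup SInf) := fun k => {H | ∀ j, H ∈ Ek j ↔ j = k}
    have hDm : ∀ k, MeasurableSet (D k) := by
      intro k
      simp only [D, Set.ofPred_forall]
      refine MeasurableSet.iInter fun j => ?_
      by_cases hjk : j = k
      · simpa [hjk] using hEk k
      · simp only [hjk, iff_false]
        exact (hEk j).compl
    have hDd : Pairwise (Function.onFun Disjoint D) := by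
      intro k l hkl
      rw [Function.onFun, Set.disjoint_left]
      intro H hk hl
      exact hkl ((hl k).1 ((hk k).2 rfl))
    have hDe : ∀ k, μ (D k) = μ (D 0) := by
      intro k
      have : D k = conjTranslate (SInf.tr n₀ (f k)) (D 0) := by
        ext H
        have h1 : ∀ j, ConjAct.toConjAct (SInf.tr n₀ (f k))⁻¹ • H ∈ Ek j ↔
            H ∈ Ek (Equiv.swap 0 k j) := fun j => by rw [← htr]; rfl
        change (∀ j, H ∈ Ek j ↔ j = k) ↔
          ∀ j, ConjAct.toConjAct (SInf.tr n₀ (f k))⁻¹ • H ∈ Ek j ↔ j = 0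
        simp only [h1]
        rw [← (Equiv.swap 0 k).forall_congr_right (q := fun j => H ∈ Ek j ↔ j = k)]
        refine forall_congr' fun j => ?_
        rw [Equiv.swap_apply_eq_iff, Equiv.swap_apply_right]
      rw [this]
      exact SMulInvariantMeasure.measure_preimage_smul _ (hDm 0)
    have h0 := measure_eq_zero_of_pairwise_disjoint hDm hDd hDe
    rw [measure_eq_zero_iff_ae_notMem] at h0
    filter_upwards [h0] with H hH hHE
    by_contra hcon
    push Not at hcon
    refine hH fun j => ?_
    rcases eq_or_ne j 0 with rfl | hj
    · refine iff_of_true ?_ rfl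
      change ConjAct.toConjAct (SInf.tr n₀ (f 0))⁻¹ • H ∈ E
      have : SInf.tr n₀ n₀ = 1 := Subtype.ext (Equiv.swap_self n₀)
      rw [hf0, this]
      simpa using hHE
    · refine iff_of_false ?_ hj
      change ConjAct.toConjAct (SInf.tr n₀ (f j))⁻¹ • H ∉ E
      rw [SInf.tr_inv]
      refine hcon _ ?_
      simp only [f, if_neg hj]
      omega
  filter_upwards [ae_all_iff.2 key] with H hH hHE M
  exact hH M hHE

theorem SInf.conj_eq_of_fixed {g σ : SInf} (h : ∀ n, g.1 n ≠ n → σ.1 n = n) :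
    σ⁻¹ * g * σ = g := by
  refine SInf.ext_apply fun n => ?_
  rw [SInf.mul_apply, SInf.mul_apply, SInf.inv_apply_eq]
  by_cases hn : g.1 n = n
  · rw [hn]
    by_contra hne
    have h1 := h _ hne
    have h2 : σ.1 n = n := σ.1.injective h1
    rw [h2] at hne
    exact hne hn
  · rw [h n hn, h (g.1 n) fun h' => hn (g.1.injective h')]

/-- The recurrence properties of almost every subgroup. -/
structure RecurrentSubgroup (H : Subgroup SInf) : Prop where
  mem : ∀ g ∈ H, ∀ n M : ℕ, ∃ m, M ≤ m ∧ SInf.tr n m * g * SInf.tr n m ∈ H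
  fixed : ∀ n, (∀ h ∈ H, h.1 n = n) → ∀ M : ℕ, ∃ m, M ≤ m ∧ ∀ h ∈ H, h.1 m = m

theorem ae_recurrentSubgroup [IsProbabilityMeasure μ]
    [SMulInvariantMeasure (ConjAct SInf) (Subgroup SInf) μ] :
    ∀ᵐ H ∂μ, RecurrentSubgroup H := by
  have h1 : ∀ g : SInf, ∀ n : ℕ, ∀ᵐ H ∂μ, g ∈ H → ∀ M, ∃ m, M ≤ m ∧
      g ∈ ConjAct.toConjAct (SInf.tr n m) • H := by
    intro g n
    refine ae_recurrent (measurableSet_subgroup_mem g) (F := g.moved) (fun σ hσ H => ?_) n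
    change g ∈ ConjAct.toConjAct σ • H ↔ g ∈ H
    rw [mem_toConjAct_smul, SInf.conj_eq_of_fixed]
    exact fun n hn => hσ n ((SInf.mem_moved g n).2 hn)
  have h2 : ∀ n : ℕ, ∀ᵐ H ∂μ, (∀ h ∈ H, h.1 n = n) → ∀ M, ∃ m, M ≤ m ∧
      ∀ h ∈ ConjAct.toConjAct (SInf.tr n m) • H, h.1 n = n := by
    intro n
    refine ae_recurrent (measurableSet_forall_fixed n) (F := {n}) (fun σ hσ H => ?_) n
    have := forall_mem_smul_iff σ H n
    rwa [hσ n (Finset.mem_singleton_self n)] at this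
  filter_upwards [ae_all_iff.2 fun g => ae_all_iff.2 (h1 g), ae_all_iff.2 h2] with H H1 H2
  refine ⟨fun g hg n M => ?_, fun n hn M => ?_⟩
  · obtain ⟨m, hm, h⟩ := H1 g n hg M
    rw [mem_toConjAct_smul, SInf.tr_inv] at h
    exact ⟨m, hm, h⟩
  · obtain ⟨m, hm, h⟩ := H2 n hn M
    have := forall_mem_smul_iff (SInf.tr n m) H m
    rw [SInf.tr_right] at this
    exact ⟨m, hm, this.1 h⟩

end Recurrence

/-! ### Normalizers of recurrent subgroups -/

section Structure

open SInf

theorem SInf.inv_mul_tr_mul (g : SInf) (a b : ℕ) : g⁻¹ * tr (g.1 a) (g.1 b) * g = tr a b := by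
  refine SInf.ext_apply fun n => ?_
  rw [mul_apply, mul_apply, inv_apply_eq, tr_apply, tr_apply]
  simp only [g.1.injective.eq_iff]
  split_ifs <;> rfl

/-- A group generated by 3-cycles contains no odd permutation, but it reaches `(a b)` up to a
transposition `(k l)` that can be placed far away. -/
theorem SInf.tr_mul_tr_eq_of_ne {a b k l : ℕ} (hab : a ≠ b) (hak : a ≠ k) (hal : a ≠ l)
    (hbk : b ≠ k) (hbl : b ≠ l) (hkl : k ≠ l) :
    (tr a k * tr b k) * (tr a k * tr b k) * (tr a l * tr b l) * (tr a k * tr b k)⁻¹ =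
      tr k l * tr a b := by
  rw [mul_inv_eq_iff_eq_mul]
  refine SInf.ext_apply fun n => ?_
  simp only [mul_apply]
  have := hab.symm
  have := hak.symm
  have := hal.symm
  have := hbk.symm
  have := hbl.symm
  have := hkl.symm
  by_cases ha : n = a
  · simp [tr_apply, *]
  by_cases hb : n = b
  · simp [tr_apply, *]
  by_cases hk : n = k
  · simp [tr_apply, *]
  by_cases hl : n = l
  · simp [tr_apply, *]
  simp [tr_apply, *]

namespace RecurrentSubgroup

variable {H : Subgroup SInf} (hH : RecurrentSubgroup H)
include hH

/-- With `b = h a` and `k` a distant point fixed by `h`, the commutator `h⁻¹ (b k) h (b k)` equals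
`(a k) (b k)`. It lies in `H` because recurrence puts `(b k) h (b k)` there. -/
theorem exists_threeCycle_mem {h : SInf} (hh : h ∈ H) (a M : ℕ) :
    ∃ k, M ≤ k ∧ a < k ∧ h.1 a < k ∧ tr a k * tr (h.1 a) k ∈ H := by
  obtain ⟨L, hL⟩ := h.moved.exists_nat_subset_range
  obtain ⟨k, hk, hmem⟩ := hH.mem h hh (h.1 a) (M + L + a + h.1 a + 1)
  refine ⟨k, by omega, by omega, by omega, ?_⟩
  have hfix : h.1 k = k := by
    by_contra hne
    have := Finset.mem_range.1 (hL ((mem_moved _ _).2 hne))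
    omega
  have := H.mul_mem (H.inv_mem hh) hmem
  have h1 := inv_mul_tr_mul h a k
  rw [hfix] at h1
  rwa [← mul_assoc, ← mul_assoc, h1] at this

/-- For `g ∈ H` take `k`, `l` beyond the support of `g`. Then `(k l) (a b)` lies in `H` and
conjugates `g` exactly as `(a b)` does, although `(a b)` itself may be missing from `H`, as for
alternating blocks. -/
theorem smul_tr_of_mem {h : SInf} (hh : h ∈ H) (a : ℕ) :
    ConjAct.toConjAct (tr a (h.1 a)) • H = H := by
  rcases eq_or_ne (h.1 a) a with ha | ha
  · have : tr a a = 1 := Subtype.ext (Equiv.swap_self a)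
    rw [ha, this]
    simp
  have key : ∀ g ∈ H, (tr a (h.1 a))⁻¹ * g * tr a (h.1 a) ∈ H := by
    intro g hg
    obtain ⟨L, hL⟩ := g.moved.exists_nat_subset_range
    have hLg : ∀ n, g.1 n ≠ n → n < L := fun n hn =>
      Finset.mem_range.1 (hL ((mem_moved _ _).2 hn))
    obtain ⟨k, hk, hka, hkb, hkm⟩ := hH.exists_threeCycle_mem hh a L
    obtain ⟨l, hl, hla, hlb, hlm⟩ := hH.exists_threeCycle_mem hh a (k + 1)
    have hs : tr k l * tr a (h.1 a) ∈ H := by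
      rw [← tr_mul_tr_eq_of_ne ha.symm hka.ne hla.ne hkb.ne hlb.ne (by omega)]
      exact H.mul_mem (H.mul_mem (H.mul_mem hkm hkm) hlm) (H.inv_mem hkm)
    have h1 := H.mul_mem (H.mul_mem (H.inv_mem hs) hg) hs
    have h2 : (tr k l)⁻¹ * g * tr k l = g := conj_eq_of_fixed fun n hn => by
      have := hLg n hn
      exact tr_of_ne (by omega) (by omega)
    have h3 : (tr k l * tr a (h.1 a))⁻¹ * g * (tr k l * tr a (h.1 a)) =
        (tr a (h.1 a))⁻¹ * ((tr k l)⁻¹ * g * tr k l) * tr a (h.1 a) := by group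
    rwa [h3, h2] at h1
  rw [smul_eq_iff_mem_normalizer]
  refine fun g => ⟨key g, fun hg => ?_⟩
  have := key _ hg
  rw [tr_inv] at this
  have h4 : tr a (h.1 a) * (tr a (h.1 a) * g * tr a (h.1 a)) * tr a (h.1 a) = g := by
    rw [mul_assoc (tr a (h.1 a)) g, ← mul_assoc, tr_mul_self, one_mul, mul_assoc, tr_mul_self,
      mul_one]
  rwa [h4] at this

theorem smul_tr {n m : ℕ} (h : orbitClass H n m) : ConjAct.toConjAct (tr n m) • H = H := by
  rcases h with ⟨h, hh, rfl⟩ | ⟨hn, hm⟩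
  · exact hH.smul_tr_of_mem hh n
  · rw [smul_eq_iff_mem_normalizer]
    have key : ∀ g ∈ H, (tr n m)⁻¹ * g * tr n m = g := fun g hg =>
      conj_eq_of_fixed fun x hx => tr_of_ne (fun h => hx (h ▸ hn g hg)) (fun h => hx (h ▸ hm g hg))
    refine fun g => ⟨fun hg => by rwa [key g hg], fun hg => ?_⟩
    have h1 := key _ hg
    have : g = (tr n m)⁻¹ * g * tr n m := by
      have h2 : tr n m * ((tr n m)⁻¹ * g * tr n m) * (tr n m)⁻¹ = g := by group
      rw [← h2]
      nth_rewrite 1 [← h1]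
      group
    rw [this]
    exact hg

/-- Multiplying by `(n, g n)` makes `n` a fixed point and keeps the hypothesis, so `g` is a product
of transpositions inside classes. -/
theorem smul_of_forall_orbitClass {g : SInf} (hg : ∀ n, orbitClass H n (g.1 n)) :
    ConjAct.toConjAct g • H = H := by
  induction hc : g.moved.card using Nat.strong_induction_on generalizing g with
  | _ c ih =>
    by_cases h1 : ∃ n, g.1 n ≠ n
    · obtain ⟨n, hn⟩ := h1
      have hlt : (tr n (g.1 n) * g).moved.card < c := by
        rw [← hc]
        refine Finset.card_lt_card (Finset.ssubset_iff_of_subset ?_ |>.2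
          ⟨n, (mem_moved _ _).2 hn, ?_⟩)
        · intro x hx
          rw [mem_moved] at hx ⊢
          intro hgx
          refine hx ?_
          rw [mul_apply, hgx, tr_of_ne]
          · rintro rfl
            exact hn hgx
          · rintro rfl
            exact hn (g.1.injective hgx)
        · rw [mem_moved, not_not, mul_apply, tr_right]
      have h2 := ih _ hlt (g := tr n (g.1 n) * g) (fun x => ?_) rfl
      · have h3 : g = tr n (g.1 n) * (tr n (g.1 n) * g) := by
          rw [← mul_assoc, tr_mul_self, one_mul]
        rw [h3, ConjAct.toConjAct_mul, mul_smul, h2, hH.smul_tr (hg n)]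
      · rw [mul_apply, tr_apply]
        split_ifs with hx hx
        · have h := hg x
          rw [hx] at h
          exact (orbitClass H).trans' h (hg n)
        · rw [g.1.injective hx]
        · exact hg x
    · push Not at h1
      have : g = 1 := SInf.ext_apply h1
      simp [this]

/-- All classes are infinite: a fixed point recurs among fixed points, and a moved point `n` is sent
to a distant `k` by a 3-cycle in `H`. -/
theorem exists_orbitClass_ge (n M : ℕ) : ∃ m, M ≤ m ∧ orbitClass H n m := by
  by_cases hn : ∀ h ∈ H, h.1 n = n
  · obtain ⟨m, hm, h⟩ := hH.fixed n hn M
    exact ⟨m, hm, Or.inr ⟨hn, h⟩⟩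
  · push Not at hn
    obtain ⟨h, hh, hne⟩ := hn
    obtain ⟨k, hk, hnk, hhk, hmem⟩ := hH.exists_threeCycle_mem hh n M
    refine ⟨k, hk, Or.inl ⟨_, hmem, ?_⟩⟩
    rw [mul_apply, tr_of_ne hne.symm hnk.ne, tr_left]

/-- The normalizer of a recurrent subgroup consists of the permutations that preserve the classes
of `orbitClass`. -/
theorem smul_eq_iff {g : SInf} :
    ConjAct.toConjAct g • H = H ↔ ∀ n, orbitClass H n (g.1 n) := by
  refine ⟨fun hg n => ?_, hH.smul_of_forall_orbitClass⟩
  obtain ⟨L, hL⟩ := g.moved.exists_nat_subset_range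
  -- Since `g` fixes this distant `m` and permutes the classes, it preserves the class shared by `m`
  -- and `n`.
  obtain ⟨m, hm, hnm⟩ := hH.exists_orbitClass_ge n L
  have hfix : g.1 m = m := by
    by_contra hne
    have := Finset.mem_range.1 (hL ((mem_moved _ _).2 hne))
    omega
  have h1 := (orbitClass_smul g H n m).2 hnm
  rw [hg, hfix] at h1
  exact (orbitClass H).trans' hnm ((orbitClass H).symm' h1)

end RecurrentSubgroup

end Structure

/-! ### The character as a product over cycles -/

section Character

/-- The event that a finite set lies in a single class. -/
def sameClass (F : Finset ℕ) : Set (Subgroup SInf) :=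
  {H | ∀ m ∈ F, ∀ n ∈ F, orbitClass H m n}

theorem measurableSet_sameClass (F : Finset ℕ) : MeasurableSet (sameClass F) := by
  simp only [sameClass, Set.ofPred_forall]
  exact MeasurableSet.iInter fun m => MeasurableSet.iInter fun _ => MeasurableSet.iInter fun n =>
    MeasurableSet.iInter fun _ => measurableSet_orbitClass m n

theorem smul_mem_sameClass_image (g : SInf) (F : Finset ℕ) (H : Subgroup SInf) :
    ConjAct.toConjAct g • H ∈ sameClass (F.image g.1) ↔ H ∈ sameClass F := by
  simp only [sameClass, Set.mem_ofPred_eq, Finset.forall_mem_image, orbitClass_smul]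

theorem conjTranslate_sameClass (g : SInf) (F : Finset ℕ) :
    conjTranslate g (sameClass F) = sameClass (F.image g.1) := by
  ext H
  change ConjAct.toConjAct g⁻¹ • H ∈ sameClass F ↔ _
  rw [← smul_mem_sameClass_image g, smul_smul, ← ConjAct.toConjAct_mul]
  simp

theorem fixInvariant_sameClass (F : Finset ℕ) : FixInvariant (sameClass F) F := by
  intro g hg H
  have h := smul_mem_sameClass_image g F H
  rwa [Finset.image_congr (g := id) fun n hn => hg n hn, Finset.image_id] at h

variable (μ : Measure (Subgroup SInf))

/-- The probability that `k` given points lie in a single class. -/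
def classProb (k : ℕ) : ℝ := μ.real (sameClass (Finset.range k))

variable {μ}

/-- Some finite permutation carries `F` onto an initial segment, so by invariance only the
cardinality matters. -/
theorem measureReal_sameClass [SMulInvariantMeasure (ConjAct SInf) (Subgroup SInf) μ]
    (F : Finset ℕ) : μ.real (sameClass F) = classProb μ F.card := by
  classical
  let e : ℕ → ℕ := fun n => if h : n ∈ F then (F.equivFin ⟨n, h⟩ : ℕ) else 0
  have he : ∀ n (h : n ∈ F), e n = F.equivFin ⟨n, h⟩ := fun n h => dif_pos h
  obtain ⟨σ, hσ⟩ := SInf.exists_extend F e (by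
    intro a ha b hb hab
    rw [he a ha, he b hb] at hab
    simpa using F.equivFin.injective (Fin.ext hab))
  have h1 : F.image σ.1 = Finset.range F.card := by
    refine Finset.eq_of_subset_of_card_le ?_ ?_
    · rw [Finset.image_subset_iff]
      intro n hn
      rw [hσ n hn, he n hn, Finset.mem_range]
      exact Fin.is_lt _
    · rw [Finset.card_image_of_injective _ σ.1.injective, Finset.card_range]
  rw [classProb, ← h1, ← conjTranslate_sameClass, measureReal_conjTranslate _
    (measurableSet_sameClass F)]

theorem classProb_one [IsProbabilityMeasure μ] : classProb μ 1 = 1 := by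
  have : sameClass (Finset.range 1) = Set.univ := by
    ext H
    simp only [sameClass, Finset.mem_range, Nat.lt_one_iff, Set.mem_ofPred_eq, Set.mem_univ,
      iff_true]
    rintro m rfl n rfl
    exact (orbitClass H).refl' 0
  rw [classProb, this, probReal_univ]

theorem classProb_zero [IsProbabilityMeasure μ] : classProb μ 0 = 1 := by
  have : sameClass (Finset.range 0) = Set.univ := by
    ext H
    simp [sameClass]
  rw [classProb, this, probReal_univ]

theorem measureReal_iInter_sameClass [IsProbabilityMeasure μ]
    [ErgodicSMul (ConjAct SInf) (Subgroup SInf) μ] (S : Finset (Finset ℕ))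
    (hS : (S : Set (Finset ℕ)).PairwiseDisjoint id) :
    μ.real (⋂ F ∈ S, sameClass F) = ∏ F ∈ S, classProb μ F.card := by
  classical
  induction S using Finset.induction_on with
  | empty => simp
  | insert F S hF ih =>
    rw [Finset.coe_insert, Set.pairwiseDisjoint_insert_of_notMem (by simpa using hF)] at hS
    rw [Finset.set_biInter_insert, Finset.prod_insert hF, ← ih hS.1, ← measureReal_sameClass]
    refine measureReal_inter_of_disjoint (measurableSet_sameClass F)
      (S.measurableSet_biInter fun F _ => measurableSet_sameClass F) (F' := S.biUnion id)
      ((Finset.disjoint_biUnion_right _ _ _).2 fun F' hF' => hS.2 F' hF')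
      (fixInvariant_sameClass F) ?_
    intro g hg H
    simp only [Set.mem_iInter]
    exact forall₂_congr fun F' hF' => fixInvariant_sameClass F' g
      (fun n hn => hg n (Finset.mem_biUnion.2 ⟨F', hF', hn⟩)) H

open Classical in
/-- The supports of the nontrivial cycles of a finite permutation. -/
def cycleSupports (g : SInf) : Finset (Finset ℕ) :=
  g.moved.image fun n => g.moved.filter fun m => g.1.SameCycle n m

theorem pairwiseDisjoint_cycleSupports (g : SInf) :
    (cycleSupports g : Set (Finset ℕ)).PairwiseDisjoint id := by
  classical
  intro F hF F' hF' hne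
  obtain ⟨a, _, rfl⟩ := Finset.mem_image.1 hF
  obtain ⟨b, _, rfl⟩ := Finset.mem_image.1 hF'
  rw [Function.onFun, Finset.disjoint_left]
  intro n hn hn'
  simp only [id, Finset.mem_filter] at hn hn'
  refine hne (Finset.filter_congr fun m _ => ?_)
  have hab := hn.2.trans hn'.2.symm
  exact ⟨fun h => hab.symm.trans h, fun h => hab.trans h⟩

theorem forall_orbitClass_iff (g : SInf) (H : Subgroup SInf) :
    (∀ n, orbitClass H n (g.1 n)) ↔ H ∈ ⋂ F ∈ cycleSupports g, sameClass F := by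
  classical
  simp only [Set.mem_iInter, cycleSupports, Finset.forall_mem_image]
  constructor
  · intro h n _ a ha b hb
    have key : ∀ (i : ℤ) (a : ℕ), orbitClass H a ((g.1 ^ i) a) := by
      intro i
      induction i using Int.induction_on with
      | zero => exact fun a => (orbitClass H).refl' a
      | succ i ih =>
        intro a
        rw [zpow_add_one]
        exact (orbitClass H).trans' (h a) (ih (g.1 a))
      | pred i ih =>
        intro a
        rw [zpow_sub_one]
        have h1 := h ((g⁻¹).1 a)
        rw [SInf.apply_inv_self] at h1
        exact (orbitClass H).trans' ((orbitClass H).symm' h1) (ih _)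
    obtain ⟨i, rfl⟩ := (Finset.mem_filter.1 ha).2.symm.trans (Finset.mem_filter.1 hb).2
    exact key i a
  · intro h n
    by_cases hn : g.1 n = n
    · rw [hn]
    · have hn' := (SInf.mem_moved g n).2 hn
      refine h hn' n (Finset.mem_filter.2 ⟨hn', .refl _ _⟩) _ (Finset.mem_filter.2 ⟨?_, ?_⟩)
      · exact (SInf.mem_moved g _).2 fun h => hn (g.1.injective h)
      · exact ⟨1, by simp⟩

theorem adCharacter_eq_prod [IsProbabilityMeasure μ]
    [ErgodicSMul (ConjAct SInf) (Subgroup SInf) μ] (g : SInf) :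
    adCharacter μ g = ∏ F ∈ cycleSupports g, classProb μ F.card := by
  rw [← measureReal_iInter_sameClass _ (pairwiseDisjoint_cycleSupports g), adCharacter]
  refine measureReal_congr ?_
  filter_upwards [ae_recurrentSubgroup (μ := μ)] with H hH
  exact propext (hH.smul_eq_iff.trans (forall_orbitClass_iff g H))

theorem adCongruent_of_classProb_eq {ν : Measure (Subgroup SInf)} (hμ : IsErgodicADMeasure μ)
    (hν : IsErgodicADMeasure ν) (h : ∀ k, 2 ≤ k → classProb μ k = classProb ν k) :
    ADCongruent μ ν := by
  have := hμ.isProbabilityMeasure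
  have := hν.isProbabilityMeasure
  have := hμ.ergodic
  have := hν.ergodic
  intro g
  rw [adCharacter_eq_prod, adCharacter_eq_prod]
  refine Finset.prod_congr rfl fun F _ => ?_
  match F.card with
  | 0 => rw [classProb_zero, classProb_zero]
  | 1 => rw [classProb_one, classProb_one]
  | k + 2 => exact h _ (by omega)

end Character

/-! ### Compactness for power sums of probability vectors -/

section PowerSums

open Filter Topology

/-- A finite family of nonnegative numbers can be rearranged into a nonincreasing sequence. -/
theorem exists_antitone_hasSum_pow {ι : Type*} (S : Finset ι) (y : ι → ℝ)
    (hy : ∀ i ∈ S, 0 ≤ y i) : ∃ x : ℕ → ℝ, Antitone x ∧ (∀ i, 0 ≤ x i) ∧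
      ∀ l ≠ 0, HasSum (fun i => x i ^ l) (∑ i ∈ S, y i ^ l) := by
  let f : Fin S.card → ℝ := fun i => y (S.equivFin.symm i)
  have hf : ∀ i, 0 ≤ f i := fun i => hy _ (S.equivFin.symm i).2
  let σ := Tuple.sort fun i => -f i
  have hσ : ∀ i j, i ≤ j → f (σ j) ≤ f (σ i) := fun i j hij =>
    neg_le_neg_iff.1 (Tuple.monotone_sort (fun i => -f i) hij)
  -- Padding with zeros does not alter power sums because `l ≠ 0`.
  refine ⟨fun i => if h : i < S.card then f (σ ⟨i, h⟩) else 0, ?_, ?_, ?_⟩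
  · intro i j hij
    dsimp only
    split_ifs with h1 h2 h2
    · exact hσ _ _ hij
    · omega
    · exact hf _
    · exact le_rfl
  · intro i
    dsimp only
    split_ifs
    · exact hf _
    · exact le_rfl
  · intro l hl
    have h1 : ∑ i ∈ S, y i ^ l = ∑ i ∈ Finset.range S.card,
        (if h : i < S.card then f (σ ⟨i, h⟩) else 0) ^ l := by
      rw [Finset.sum_range]
      simp only [Fin.is_lt, dite_true]
      rw [Equiv.sum_comp σ fun i => f i ^ l, ← S.sum_coe_sort,
        ← Equiv.sum_comp S.equivFin.symm]
    rw [h1]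
    refine hasSum_sum_of_ne_finset_zero fun i hi => ?_
    have hi' : ¬ i < S.card := fun h => hi (Finset.mem_range.2 h)
    simp only [dif_neg hi', zero_pow hl]

/-- The first `i + 1` terms are all at least `x i`. This bound, uniform in the vector, dominates the
power sums. -/
theorem Antitone.le_one_div_of_hasSum {x : ℕ → ℝ} (hx : Antitone x) (h0 : ∀ i, 0 ≤ x i)
    (h1 : HasSum x 1) (i : ℕ) : x i ≤ 1 / ((i : ℝ) + 1) := by
  have h2 : ∑ j ∈ Finset.range (i + 1), x i ≤ ∑ j ∈ Finset.range (i + 1), x j :=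
    Finset.sum_le_sum fun j hj => hx (Nat.lt_succ_iff.1 (Finset.mem_range.1 hj))
  have h3 := sum_le_hasSum (Finset.range (i + 1)) (fun j _ => h0 j) h1
  rw [Finset.sum_const, Finset.card_range, nsmul_eq_mul] at h2
  push_cast at h2
  rw [le_div_iff₀ (by positivity)]
  linarith

/-- Limits of power sums of nonincreasing probability vectors are power sums. -/
theorem exists_hasSum_pow_of_approx {p : ℕ → ℝ}
    (h : ∀ L : ℕ, ∃ x : ℕ → ℝ, Antitone x ∧ (∀ i, 0 ≤ x i) ∧ HasSum x 1 ∧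
      ∀ l, 2 ≤ l → l ≤ L → |∑' i, x i ^ l - p l| ≤ 1 / ((L : ℝ) + 1)) :
    ∃ a : ℕ → ℝ, Antitone a ∧ (∀ i, 0 ≤ a i) ∧ Summable a ∧ ∑' i, a i ≤ 1 ∧
      ∀ l, 2 ≤ l → HasSum (fun i => a i ^ l) (p l) := by
  choose x hxa hx0 hx1 hxp using h
  have hxle : ∀ L i, x L i ≤ 1 / ((i : ℝ) + 1) := fun L i =>
    (hxa L).le_one_div_of_hasSum (hx0 L) (hx1 L) i
  have hK : IsCompact (Set.univ.pi fun _ : ℕ => Set.Icc (0 : ℝ) 1) :=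
    isCompact_univ_pi fun _ => isCompact_Icc
  obtain ⟨a, -, φ, hφ, ha⟩ := hK.tendsto_subseq (x := x) fun L i _ =>
    ⟨hx0 L i, (hxle L i).trans (by
      rw [div_le_one (by positivity)]
      have : (0 : ℝ) ≤ i := by positivity
      linarith)⟩
  have ha' : ∀ i, Tendsto (fun k => x (φ k) i) atTop (𝓝 (a i)) := fun i =>
    (continuous_apply i).continuousAt.tendsto.comp ha
  have ha0 : ∀ i, 0 ≤ a i := fun i => ge_of_tendsto' (ha' i) fun k => hx0 _ i
  have hale : ∀ i, a i ≤ 1 / ((i : ℝ) + 1) := fun i => le_of_tendsto' (ha' i) fun k => hxle _ i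
  have hafin : ∀ s : Finset ℕ, ∑ i ∈ s, a i ≤ 1 := fun s =>
    le_of_tendsto' (tendsto_finsetSum s fun i _ => ha' i) fun k =>
      sum_le_hasSum s (fun i _ => hx0 _ i) (hx1 _)
  refine ⟨a, fun i j hij => le_of_tendsto_of_tendsto' (ha' j) (ha' i) fun k => hxa _ hij, ha0,
    summable_of_sum_le ha0 hafin, Real.tsum_le_of_sum_le ha0 hafin, fun l hl => ?_⟩
  -- Summability needs `l ≥ 2`. For `l = 1` mass may escape in the limit, which is why the sum of
  -- `a` is only bounded by one here.
  have hbound : Summable fun i : ℕ => (1 / ((i : ℝ) + 1)) ^ l := by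
    have := (summable_nat_add_iff 1).2 (Real.summable_one_div_nat_pow.2 (show 1 < l by omega))
    refine this.congr fun i => ?_
    push_cast
    rw [div_pow, one_pow]
  have hlim : Tendsto (fun k => ∑' i, x (φ k) i ^ l) atTop (𝓝 (∑' i, a i ^ l)) := by
    refine tendsto_tsum_of_dominated_convergence hbound (fun i => (ha' i).pow l)
      (Eventually.of_forall fun k i => ?_)
    rw [Real.norm_eq_abs, abs_of_nonneg (pow_nonneg (hx0 _ i) l)]
    exact pow_le_pow_left₀ (hx0 _ i) (hxle _ i) l
  have hlim' : Tendsto (fun k => ∑' i, x (φ k) i ^ l) atTop (𝓝 (p l)) := by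
    rw [tendsto_iff_norm_sub_tendsto_zero]
    have h0 : Tendsto (fun k => 1 / ((φ k : ℝ) + 1)) atTop (𝓝 0) :=
      tendsto_one_div_add_atTop_nhds_zero_nat.comp hφ.tendsto_atTop
    refine tendsto_of_tendsto_of_tendsto_of_le_of_le' tendsto_const_nhds h0
      (Eventually.of_forall fun k => norm_nonneg _) ?_
    filter_upwards [hφ.tendsto_atTop.eventually_ge_atTop l] with k hk
    exact hxp (φ k) l hl hk
  have hs : Summable fun i => a i ^ l := Summable.of_nonneg_of_le (fun i => pow_nonneg (ha0 i) l)
    (fun i => pow_le_pow_left₀ (ha0 i) (hale i) l) hbound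
  rw [← tendsto_nhds_unique hlim hlim']
  exact hs.hasSum

end PowerSums

/-! ### Counting tuples -/

section Tuples

variable {α : Type*} [Fintype α]

open Classical in
/-- The classes of an equivalence relation on a finite type. -/
def classFinsets (r : Setoid α) : Finset (Finset α) :=
  Finset.univ.image fun a => Finset.univ.filter fun b => r a b

open Classical in
/-- The number of tuples in a single class is a power sum of the sizes of the classes. -/
theorem card_filter_forall_rel (r : Setoid α) {l : ℕ} (hl : l ≠ 0) :
    (Finset.univ.filter fun f : Fin l → α => ∀ i j, r (f i) (f j)).card =
      ∑ Q ∈ classFinsets r, Q.card ^ l := by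
  have : NeZero l := ⟨hl⟩
  have h1 : (Finset.univ.filter fun f : Fin l → α => ∀ i j, r (f i) (f j)) =
      (classFinsets r).biUnion fun Q => Fintype.piFinset fun _ : Fin l => Q := by
    ext f
    simp only [Finset.mem_filter, Finset.mem_univ, true_and, Finset.mem_biUnion, classFinsets,
      Finset.mem_image, exists_exists_eq_and, Fintype.mem_piFinset]
    constructor
    · exact fun h => ⟨f 0, fun i => h 0 i⟩
    · rintro ⟨a, ha⟩ i j
      exact r.trans' (r.symm' (ha i)) (ha j)
  rw [h1, Finset.card_biUnion]
  · exact Finset.sum_congr rfl fun Q _ => by simp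
  · intro Q hQ Q' hQ' hne
    obtain ⟨a, _, rfl⟩ := Finset.mem_image.1 hQ
    obtain ⟨b, _, rfl⟩ := Finset.mem_image.1 hQ'
    rw [Function.onFun, Finset.disjoint_left]
    intro f hf hf'
    have h2 := Fintype.mem_piFinset.1 hf 0
    have h3 := Fintype.mem_piFinset.1 hf' 0
    simp only [Finset.mem_filter, Finset.mem_univ, true_and] at h2 h3
    have hab := r.trans' h2 (r.symm' h3)
    refine hne (Finset.filter_congr fun c _ => ?_)
    exact ⟨fun h => r.trans' (r.symm' hab) h, fun h => r.trans' hab h⟩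

theorem card_filter_not_injective (ι : Type*) [Fintype ι] [DecidableEq ι] (N : ℕ)
    [DecidablePred fun f : ι → Fin N => ¬ Function.Injective f] :
    ((Finset.univ.filter fun f : ι → Fin N => ¬ Function.Injective f).card : ℝ) =
      (N : ℝ) ^ Fintype.card ι - N.descFactorial (Fintype.card ι) := by
  classical
  have h1 : (Finset.univ.filter fun f : ι → Fin N => Function.Injective f).card =
      N.descFactorial (Fintype.card ι) := by
    rw [← Fintype.card_subtype, Fintype.card_congr (Equiv.subtypeInjectiveEquivEmbedding ι (Fin N)),
      Fintype.card_embedding_eq, Fintype.card_fin]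
  have h2 := Finset.card_filter_add_card_filter_not (s := (Finset.univ : Finset (ι → Fin N)))
    (fun f => Function.Injective f)
  rw [Finset.card_univ, Fintype.card_fun, Fintype.card_fin, h1] at h2
  have h3 : (N.descFactorial (Fintype.card ι) : ℝ) +
      ((Finset.univ.filter fun f : ι → Fin N => ¬ Function.Injective f).card : ℝ) =
      (N : ℝ) ^ Fintype.card ι := by exact_mod_cast h2
  linarith

open Filter Topology in
theorem tendsto_descFactorial_div_pow (k : ℕ) :
    Tendsto (fun N : ℕ => (N.descFactorial k : ℝ) / (N : ℝ) ^ k) atTop (𝓝 1) := by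
  have h1 : Tendsto (fun N : ℕ => (1 + (1 - (k : ℝ)) / N) ^ k) atTop (𝓝 ((1 + 0) ^ k)) :=
    (tendsto_const_nhds.add (tendsto_const_div_atTop_nhds_zero_nat _)).pow k
  rw [add_zero, one_pow] at h1
  refine tendsto_of_tendsto_of_tendsto_of_le_of_le' h1 tendsto_const_nhds ?_ ?_
  · filter_upwards [eventually_ge_atTop (k + 1)] with N hN
    have hN0 : (N : ℝ) ≠ 0 := by
      have : 0 < N := by omega
      positivity
    have h2 : 1 + (1 - (k : ℝ)) / N = ((N + 1 - k : ℕ) : ℝ) / N := by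
      rw [Nat.cast_sub (by omega)]
      field_simp
      push_cast
      ring
    rw [h2, div_pow]
    gcongr
    exact_mod_cast Nat.pow_sub_le_descFactorial N k
  · filter_upwards with N
    refine div_le_one_of_le₀ ?_ (by positivity)
    exact_mod_cast Nat.descFactorial_le_pow N k

end Tuples

/-! ### Class frequencies and the second moment method -/

section Frequencies

open Filter Topology

variable {μ : Measure (Subgroup SInf)}

open Classical in
/-- The proportion of the `l`-tuples of points below `N` that lie in a single class. -/
def tupleFreq (N l : ℕ) (H : Subgroup SInf) : ℝ :=
  ((Finset.univ.filter fun f : Fin l → Fin N =>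
    ∀ i j, orbitClass H (f i) (f j)).card : ℝ) / (N : ℝ) ^ l

/-- The set of values of a tuple. -/
def tupleSet {l N : ℕ} (f : Fin l → Fin N) : Finset ℕ := Finset.univ.image fun i => (f i : ℕ)

theorem mem_sameClass_tupleSet {l N : ℕ} (f : Fin l → Fin N) (H : Subgroup SInf) :
    H ∈ sameClass (tupleSet f) ↔ ∀ i j, orbitClass H (f i) (f j) := by
  simp [sameClass, tupleSet]

theorem card_tupleSet {l N : ℕ} {f : Fin l → Fin N} (hf : Function.Injective f) :
    (tupleSet f).card = l := by
  rw [tupleSet]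
  exact (Finset.card_image_of_injective _ (Fin.val_injective.comp hf)).trans (by simp)

/-- The entries of `x` are the proportions of the points below `N` taken by the classes, in
nonincreasing order; their `l`-th power sum counts `l`-tuples inside one class. -/
theorem exists_antitone_hasSum_tupleFreq {N : ℕ} (hN : 0 < N) (H : Subgroup SInf) :
    ∃ x : ℕ → ℝ, Antitone x ∧ (∀ i, 0 ≤ x i) ∧ HasSum x 1 ∧
      ∀ l ≠ 0, HasSum (fun i => x i ^ l) (tupleFreq N l H) := by
  classical
  let r : Setoid (Fin N) := (orbitClass H).comap Fin.val
  obtain ⟨x, hx, hx0, hxs⟩ := exists_antitone_hasSum_pow (classFinsets r)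
    (fun Q => (Q.card : ℝ) / N) fun _ _ => by positivity
  have h1 : ∀ l ≠ 0, ∑ Q ∈ classFinsets r, ((Q.card : ℝ) / N) ^ l = tupleFreq N l H := by
    intro l hl
    simp only [div_pow]
    rw [← Finset.sum_div, tupleFreq]
    congr 1
    have := card_filter_forall_rel r hl
    exact_mod_cast this.symm
  have h2 : tupleFreq N 1 H = 1 := by
    have : (Finset.univ.filter fun f : Fin 1 → Fin N => ∀ i j, orbitClass H (f i) (f j)) =
        Finset.univ := by
      refine Finset.filter_true_of_mem fun f _ i j => ?_
      rw [Subsingleton.elim i j]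
    rw [tupleFreq, this]
    have : (N : ℝ) ≠ 0 := by positivity
    simp [this]
  refine ⟨x, hx, hx0, ?_, fun l hl => h1 l hl ▸ hxs l hl⟩
  have := hxs 1 one_ne_zero
  rw [h1 1 one_ne_zero, h2] at this
  simpa using this

/-- The centred indicator function of the event that a tuple lies in a single class. -/
def tupleDeviation (μ : Measure (Subgroup SInf)) {l N : ℕ} (f : Fin l → Fin N)
    (H : Subgroup SInf) : ℝ :=
  (sameClass (tupleSet f)).indicator 1 H - classProb μ l

theorem abs_tupleDeviation_le [IsProbabilityMeasure μ] {l N : ℕ} (f : Fin l → Fin N)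
    (H : Subgroup SInf) : |tupleDeviation μ f H| ≤ 1 := by
  have h0 : 0 ≤ classProb μ l := measureReal_nonneg
  have h1 : classProb μ l ≤ 1 := measureReal_le_one
  rw [tupleDeviation, abs_le]
  by_cases h : H ∈ sameClass (tupleSet f)
  · rw [Set.indicator_of_mem h, Pi.one_apply]
    constructor <;> linarith
  · rw [Set.indicator_of_notMem h]
    constructor <;> linarith

theorem measurable_tupleDeviation {l N : ℕ} (f : Fin l → Fin N) :
    Measurable (tupleDeviation μ f) :=
  (measurable_one.indicator (measurableSet_sameClass _)).sub_const _

theorem integrable_tupleDeviation_mul [IsProbabilityMeasure μ] {l N : ℕ} (f f' : Fin l → Fin N) :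
    Integrable (fun H => tupleDeviation μ f H * tupleDeviation μ f' H) μ := by
  refine Integrable.of_bound
    ((measurable_tupleDeviation f).mul (measurable_tupleDeviation f')).aestronglyMeasurable 1
    (Eventually.of_forall fun H => ?_)
  rw [norm_mul]
  exact mul_le_one₀ (abs_tupleDeviation_le f H) (norm_nonneg _) (abs_tupleDeviation_le f' H)

theorem integral_tupleDeviation_mul_le [IsProbabilityMeasure μ] {l N : ℕ} (f f' : Fin l → Fin N) :
    ∫ H, tupleDeviation μ f H * tupleDeviation μ f' H ∂μ ≤ 1 := by
  calc ∫ H, tupleDeviation μ f H * tupleDeviation μ f' H ∂μ ≤ ∫ _, (1 : ℝ) ∂μ := by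
        refine integral_mono (integrable_tupleDeviation_mul f f') (integrable_const _) fun H => ?_
        refine (le_abs_self _).trans ?_
        rw [abs_mul]
        exact mul_le_one₀ (abs_tupleDeviation_le f H) (abs_nonneg _) (abs_tupleDeviation_le f' H)
    _ = 1 := by simp

theorem integral_tupleDeviation_mul_eq_zero [IsProbabilityMeasure μ]
    [ErgodicSMul (ConjAct SInf) (Subgroup SInf) μ] {l N : ℕ} {f f' : Fin l → Fin N}
    (h : Function.Injective (Sum.elim f f')) :
    ∫ H, tupleDeviation μ f H * tupleDeviation μ f' H ∂μ = 0 := by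
  have hf : Function.Injective f := h.comp Sum.inl_injective
  have hf' : Function.Injective f' := h.comp Sum.inr_injective
  have hd : Disjoint (tupleSet f) (tupleSet f') := by
    rw [Finset.disjoint_left]
    intro n hn hn'
    obtain ⟨i, _, rfl⟩ := Finset.mem_image.1 hn
    obtain ⟨j, _, hj⟩ := Finset.mem_image.1 hn'
    have := @h (Sum.inr j) (Sum.inl i) (Fin.ext hj)
    cases this
  have hm := measurableSet_sameClass (tupleSet f)
  have hm' := measurableSet_sameClass (tupleSet f')
  have hI := measureReal_inter_of_disjoint (μ := μ) hm hm' hd (fixInvariant_sameClass _)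
    (fixInvariant_sameClass _)
  have e : μ.real (sameClass (tupleSet f)) = classProb μ l := by
    rw [measureReal_sameClass, card_tupleSet hf]
  have e' : μ.real (sameClass (tupleSet f')) = classProb μ l := by
    rw [measureReal_sameClass, card_tupleSet hf']
  have i1 : Integrable ((sameClass (tupleSet f)).indicator (1 : Subgroup SInf → ℝ)) μ :=
    (integrable_const (1 : ℝ)).indicator hm
  have i2 : Integrable ((sameClass (tupleSet f')).indicator (1 : Subgroup SInf → ℝ)) μ :=
    (integrable_const (1 : ℝ)).indicator hm'
  have i3 : Integrable ((sameClass (tupleSet f) ∩ sameClass (tupleSet f')).indicator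
      (1 : Subgroup SInf → ℝ)) μ := (integrable_const (1 : ℝ)).indicator (hm.inter hm')
  have hexp : ∀ H, tupleDeviation μ f H * tupleDeviation μ f' H =
      (sameClass (tupleSet f) ∩ sameClass (tupleSet f')).indicator 1 H -
      classProb μ l * (sameClass (tupleSet f)).indicator 1 H -
      classProb μ l * (sameClass (tupleSet f')).indicator 1 H + classProb μ l ^ 2 := by
    intro H
    rw [Set.inter_indicator_one]
    simp only [tupleDeviation, Pi.mul_apply]
    ring
  simp only [hexp]
  have i4 : Integrable (fun H => (sameClass (tupleSet f) ∩ sameClass (tupleSet f')).indicator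
      (1 : Subgroup SInf → ℝ) H - classProb μ l * (sameClass (tupleSet f)).indicator 1 H) μ :=
    i3.sub (i1.const_mul _)
  have i5 : Integrable (fun H => (sameClass (tupleSet f) ∩ sameClass (tupleSet f')).indicator
      (1 : Subgroup SInf → ℝ) H - classProb μ l * (sameClass (tupleSet f)).indicator 1 H -
      classProb μ l * (sameClass (tupleSet f')).indicator 1 H) μ := i4.sub (i2.const_mul _)
  rw [integral_add i5 (integrable_const _), integral_sub i4 (i2.const_mul _),
    integral_sub i3 (i1.const_mul _),
    integral_const_mul, integral_const_mul, integral_indicator_one hm, integral_indicator_one hm',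
    integral_indicator_one (hm.inter hm'), hI, e, e']
  simp
  ring

theorem tupleFreq_sub {N : ℕ} (hN : 0 < N) (l : ℕ) (H : Subgroup SInf) :
    tupleFreq N l H - classProb μ l =
      (∑ f : Fin l → Fin N, tupleDeviation μ f H) / (N : ℝ) ^ l := by
  classical
  have hN' : (N : ℝ) ^ l ≠ 0 := by positivity
  have h1 : ∑ f : Fin l → Fin N, (sameClass (tupleSet f)).indicator (1 : Subgroup SInf → ℝ) H =
      (Finset.univ.filter fun f : Fin l → Fin N => ∀ i j, orbitClass H (f i) (f j)).card := by
    rw [Finset.card_filter]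
    push_cast
    refine Finset.sum_congr rfl fun f _ => ?_
    rw [Set.indicator_apply]
    exact if_congr (mem_sameClass_tupleSet f H) rfl rfl
  simp only [tupleDeviation]
  rw [Finset.sum_sub_distrib, h1, Finset.sum_const, Finset.card_univ, Fintype.card_fun,
    Fintype.card_fin, Fintype.card_fin, nsmul_eq_mul, tupleFreq]
  push_cast
  field_simp

theorem sq_tupleFreq_sub {N : ℕ} (hN : 0 < N) (l : ℕ) (H : Subgroup SInf) :
    (tupleFreq N l H - classProb μ l) ^ 2 = (∑ f : Fin l → Fin N, ∑ f' : Fin l → Fin N,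
      tupleDeviation μ f H * tupleDeviation μ f' H) / (N : ℝ) ^ (2 * l) := by
  rw [tupleFreq_sub hN, div_pow, sq (∑ f : Fin l → Fin N, _), Finset.sum_mul_sum, ← pow_mul,
    mul_comm l 2]

theorem integrable_sq_tupleFreq_sub [IsProbabilityMeasure μ] {N : ℕ} (hN : 0 < N) (l : ℕ) :
    Integrable (fun H => (tupleFreq N l H - classProb μ l) ^ 2) μ := by
  simp only [sq_tupleFreq_sub hN]
  exact (integrable_finsetSum _ fun f _ => integrable_finsetSum _ fun f' _ =>
    integrable_tupleDeviation_mul f f').div_const _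

/-- By independence, pairs of tuples with `2 * l` distinct entries contribute nothing to the
variance. Every other pair contributes at most one, and such pairs become a negligible fraction as
`N` grows. -/
theorem integral_sq_tupleFreq_sub_le [IsProbabilityMeasure μ]
    [ErgodicSMul (ConjAct SInf) (Subgroup SInf) μ] {N : ℕ} (hN : 0 < N) (l : ℕ) :
    ∫ H, (tupleFreq N l H - classProb μ l) ^ 2 ∂μ ≤
      1 - (N.descFactorial (2 * l) : ℝ) / (N : ℝ) ^ (2 * l) := by
  classical
  have hN' : (N : ℝ) ^ (2 * l) ≠ 0 := by positivity
  simp only [sq_tupleFreq_sub hN]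
  rw [integral_div, integral_finsetSum _ fun f _ => integrable_finsetSum _ fun f' _ =>
    integrable_tupleDeviation_mul f f']
  have h1 : ∀ f : Fin l → Fin N, ∫ H, ∑ f' : Fin l → Fin N,
      tupleDeviation μ f H * tupleDeviation μ f' H ∂μ ≤
      ∑ f' : Fin l → Fin N, if ¬ Function.Injective (Sum.elim f f') then (1 : ℝ) else 0 := by
    intro f
    rw [integral_finsetSum _ fun f' _ => integrable_tupleDeviation_mul f f']
    refine Finset.sum_le_sum fun f' _ => ?_
    by_cases h : Function.Injective (Sum.elim f f')
    · rw [if_neg (not_not.2 h)]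
      exact (integral_tupleDeviation_mul_eq_zero h).le
    · rw [if_pos h]
      exact integral_tupleDeviation_mul_le f f'
  have h2 : ∑ f : Fin l → Fin N, ∑ f' : Fin l → Fin N,
      (if ¬ Function.Injective (Sum.elim f f') then (1 : ℝ) else 0) =
      (N : ℝ) ^ (2 * l) - N.descFactorial (2 * l) := by
    have h3 := card_filter_not_injective (Fin l ⊕ Fin l) N
    rw [Fintype.card_sum, Fintype.card_fin, ← two_mul, Finset.card_filter] at h3
    rw [← h3, ← Fintype.sum_prod_type', ← Equiv.sum_comp (Equiv.sumArrowEquivProdArrow _ _ _).symm]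
    push_cast
    rfl
  calc (∑ f : Fin l → Fin N, ∫ H, ∑ f' : Fin l → Fin N,
      tupleDeviation μ f H * tupleDeviation μ f' H ∂μ) / (N : ℝ) ^ (2 * l)
      ≤ ((N : ℝ) ^ (2 * l) - N.descFactorial (2 * l)) / (N : ℝ) ^ (2 * l) := by
        rw [← h2]
        gcongr with f
        exact h1 f
    _ = 1 - (N.descFactorial (2 * l) : ℝ) / (N : ℝ) ^ (2 * l) := by
        field_simp

/-- Some subgroup has class frequencies with power sums close to the class probabilities. -/
theorem exists_tupleFreq_close [IsProbabilityMeasure μ]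
    [ErgodicSMul (ConjAct SInf) (Subgroup SInf) μ] (L : ℕ) {ε : ℝ} (hε : 0 < ε) :
    ∃ N, 0 < N ∧ ∃ H : Subgroup SInf, ∀ l ≤ L, |tupleFreq N l H - classProb μ l| ≤ ε := by
  have h1 : Tendsto (fun N : ℕ => ∑ l ∈ Finset.range (L + 1),
      (1 - (N.descFactorial (2 * l) : ℝ) / (N : ℝ) ^ (2 * l))) atTop (𝓝 0) := by
    have := tendsto_finsetSum (Finset.range (L + 1)) fun l _ =>
      (tendsto_const_nhds (x := (1 : ℝ))).sub (tendsto_descFactorial_div_pow (2 * l))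
    simpa using this
  obtain ⟨N, hNε, hN⟩ := ((h1.eventually (gt_mem_nhds (pow_pos hε 2))).and
    (eventually_gt_atTop 0)).exists
  refine ⟨N, hN, ?_⟩
  have hi : Integrable (fun H => ∑ l ∈ Finset.range (L + 1),
      (tupleFreq N l H - classProb μ l) ^ 2) μ :=
    integrable_finsetSum _ fun l _ => integrable_sq_tupleFreq_sub hN l
  -- A nonnegative sum of squares with small mean is small at some point, which gives one `H` for
  -- all `l ≤ L` at once.
  obtain ⟨H, hH⟩ := exists_le_integral hi
  refine ⟨H, fun l hl => ?_⟩
  have h2 : ∑ l ∈ Finset.range (L + 1), (tupleFreq N l H - classProb μ l) ^ 2 ≤ ε ^ 2 := by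
    refine hH.trans (le_trans ?_ hNε.le)
    rw [integral_finsetSum _ fun l _ => integrable_sq_tupleFreq_sub hN l]
    exact Finset.sum_le_sum fun l _ => integral_sq_tupleFreq_sub_le hN l
  have h3 := Finset.single_le_sum (f := fun l => (tupleFreq N l H - classProb μ l) ^ 2)
    (fun l _ => sq_nonneg _) (Finset.mem_range.2 (Nat.lt_succ_of_le hl))
  exact abs_le_of_sq_le_sq (h3.trans h2) hε.le

theorem exists_hasSum_pow_classProb [IsProbabilityMeasure μ]
    [ErgodicSMul (ConjAct SInf) (Subgroup SInf) μ] :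
    ∃ a : ℕ → ℝ, Antitone a ∧ (∀ i, 0 ≤ a i) ∧ Summable a ∧ ∑' i, a i ≤ 1 ∧
      ∀ l, 2 ≤ l → HasSum (fun i => a i ^ l) (classProb μ l) := by
  refine exists_hasSum_pow_of_approx fun L => ?_
  obtain ⟨N, hN, H, hH⟩ := exists_tupleFreq_close (μ := μ) L
    (show (0 : ℝ) < 1 / ((L : ℝ) + 1) by positivity)
  obtain ⟨x, hx, hx0, hx1, hxs⟩ := exists_antitone_hasSum_tupleFreq hN H
  refine ⟨x, hx, hx0, hx1, fun l hl hlL => ?_⟩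
  rw [(hxs l (by omega)).tsum_eq]
  exact hH l hlL

end Frequencies

/-! ### No mass is lost -/

section Mass

open Filter Topology

variable {μ : Measure (Subgroup SInf)}

/-- The event that `0` is not equivalent to any of the points `1, …, K`. -/
def isolatedUpTo (K : ℕ) : Set (Subgroup SInf) := {H | ∀ j < K, ¬ orbitClass H 0 (j + 1)}

theorem measurableSet_isolatedUpTo (K : ℕ) : MeasurableSet (isolatedUpTo K) := by
  simp only [isolatedUpTo, Set.ofPred_forall]
  exact MeasurableSet.iInter fun j => MeasurableSet.iInter fun _ =>
    (measurableSet_orbitClass 0 (j + 1)).compl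

/-- The point `0` together with the successors of the elements of `J`. -/
def insertZeroSucc (J : Finset ℕ) : Finset ℕ := insert 0 (J.map (addRightEmbedding 1))

theorem card_insertZeroSucc (J : Finset ℕ) : (insertZeroSucc J).card = J.card + 1 := by
  rw [insertZeroSucc, Finset.card_insert_of_notMem (by simp), Finset.card_map]

theorem mem_sameClass_insertZeroSucc (J : Finset ℕ) (H : Subgroup SInf) :
    H ∈ sameClass (insertZeroSucc J) ↔ ∀ j ∈ J, orbitClass H 0 (j + 1) := by
  constructor
  · intro h j hj
    exact h 0 (by simp [insertZeroSucc]) (j + 1) (by simp [insertZeroSucc, hj])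
  · intro h
    have h0 : ∀ m ∈ insertZeroSucc J, orbitClass H 0 m := by
      intro m hm
      simp only [insertZeroSucc, Finset.mem_insert, Finset.mem_map, addRightEmbedding_apply] at hm
      rcases hm with rfl | ⟨j, hj, rfl⟩
      · exact (orbitClass H).refl' 0
      · exact h j hj
    exact fun m hm n hn => (orbitClass H).trans' ((orbitClass H).symm' (h0 m hm)) (h0 n hn)

/-- Inclusion–exclusion: expand the product of the factors `1 - y j`, with `y j` the indicator of `0
∼ j + 1`. -/
theorem indicator_isolatedUpTo (K : ℕ) (H : Subgroup SInf) :
    (isolatedUpTo K).indicator (1 : Subgroup SInf → ℝ) H =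
      ∑ J ∈ (Finset.range K).powerset, (-1) ^ J.card *
        (sameClass (insertZeroSucc J)).indicator (1 : Subgroup SInf → ℝ) H := by
  classical
  let y : ℕ → ℝ := fun j => if orbitClass H 0 (j + 1) then 1 else 0
  have h1 : (isolatedUpTo K).indicator (1 : Subgroup SInf → ℝ) H =
      ∏ j ∈ Finset.range K, (-y j + 1) := by
    by_cases h : H ∈ isolatedUpTo K
    · rw [Set.indicator_of_mem h]
      refine (Finset.prod_eq_one fun j hj => ?_).symm
      simp only [y, if_neg (h j (Finset.mem_range.1 hj))]
      simp
    · rw [Set.indicator_of_notMem h]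
      simp only [isolatedUpTo, Set.mem_ofPred_eq] at h
      push Not at h
      obtain ⟨j, hj, hj'⟩ := h
      refine (Finset.prod_eq_zero (Finset.mem_range.2 hj) ?_).symm
      simp only [y, if_pos hj']
      simp
  rw [h1, Finset.prod_add]
  refine Finset.sum_congr rfl fun J _ => ?_
  rw [Finset.prod_const_one, mul_one, Finset.prod_neg]
  congr 1
  by_cases h : H ∈ sameClass (insertZeroSucc J)
  · rw [Set.indicator_of_mem h]
    rw [mem_sameClass_insertZeroSucc] at h
    refine Finset.prod_eq_one fun j hj => if_pos (h j hj)
  · rw [Set.indicator_of_notMem h]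
    rw [mem_sameClass_insertZeroSucc] at h
    push Not at h
    obtain ⟨j, hj, hj'⟩ := h
    exact Finset.prod_eq_zero hj (if_neg hj')

theorem measureReal_isolatedUpTo [IsProbabilityMeasure μ]
    [SMulInvariantMeasure (ConjAct SInf) (Subgroup SInf) μ] (K : ℕ) :
    μ.real (isolatedUpTo K) =
      ∑ J ∈ (Finset.range K).powerset, (-1) ^ J.card * classProb μ (J.card + 1) := by
  rw [← integral_indicator_one (measurableSet_isolatedUpTo K)]
  simp only [indicator_isolatedUpTo]
  rw [integral_finsetSum]
  · refine Finset.sum_congr rfl fun J _ => ?_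
    rw [integral_const_mul, integral_indicator_one (measurableSet_sameClass _),
      measureReal_sameClass, card_insertZeroSucc]
  · exact fun J _ => (((integrable_const (1 : ℝ)).indicator (measurableSet_sameClass _)).const_mul _)

theorem tendsto_measure_isolatedUpTo [IsProbabilityMeasure μ]
    [SMulInvariantMeasure (ConjAct SInf) (Subgroup SInf) μ] :
    Tendsto (fun K => μ.real (isolatedUpTo K)) atTop (𝓝 0) := by
  have h1 : μ (⋂ K, isolatedUpTo K) = 0 := by
    rw [measure_eq_zero_iff_ae_notMem]
    filter_upwards [ae_recurrentSubgroup (μ := μ)] with H hH hmem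
    obtain ⟨m, hm, h⟩ := hH.exists_orbitClass_ge 0 1
    obtain ⟨j, rfl⟩ : ∃ j, m = j + 1 := ⟨m - 1, by omega⟩
    exact Set.mem_iInter.1 hmem (j + 1) j (Nat.lt_succ_self j) h
  have h2 := tendsto_measure_iInter_atTop (μ := μ)
    (fun K => (measurableSet_isolatedUpTo K).nullMeasurableSet)
    (fun K L hKL H hH j hj => hH j (hj.trans_le hKL)) ⟨0, measure_ne_top μ _⟩
  rw [h1] at h2
  have h3 := (ENNReal.tendsto_toReal ENNReal.zero_ne_top).comp h2
  simpa [Function.comp_def, measureReal_def] using h3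

theorem sum_powerset_neg_one_pow_mul (K : ℕ) (a : ℝ) :
    ∑ J ∈ (Finset.range K).powerset, (-1) ^ J.card * a ^ (J.card + 1) = a * (1 - a) ^ K := by
  have h := Finset.sum_pow_mul_eq_add_pow (-a) 1 (Finset.range K)
  rw [Finset.card_range] at h
  rw [show 1 - a = -a + 1 by ring, ← h, Finset.mul_sum]
  refine Finset.sum_congr rfl fun J _ => ?_
  rw [one_pow, mul_one, neg_pow a, pow_succ]
  ring

/-- If the class probabilities of an ergodic measure are power sums of a summable sequence, then
the sequence has sum at least one: almost surely no class is a single point. -/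
theorem one_le_tsum_of_hasSum_classProb [IsProbabilityMeasure μ]
    [SMulInvariantMeasure (ConjAct SInf) (Subgroup SInf) μ] {a : ℕ → ℝ} (ha : ∀ i, 0 ≤ a i)
    (hs : Summable a) (hs1 : ∑' i, a i ≤ 1)
    (h : ∀ l, 2 ≤ l → HasSum (fun i => a i ^ l) (classProb μ l)) : 1 ≤ ∑' i, a i := by
  have ha1 : ∀ i, a i ≤ 1 := fun i => (hs.le_tsum i fun j _ => ha j).trans hs1
  have key : ∀ K, 1 - ∑' i, a i ≤ μ.real (isolatedUpTo K) := by
    intro K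
    -- The power sum formula holds only from `l = 2` on. The empty `J` involves `classProb μ 1 = 1`
    -- in place of `∑ a_i`, whence the correction. Nonnegativity of the left side then bounds the
    -- missing mass by the probability that `0` is isolated, which tends to zero.
    have h1 : HasSum (fun i => a i * (1 - a i) ^ K) (∑ J ∈ (Finset.range K).powerset,
        (-1) ^ J.card * (classProb μ (J.card + 1) -
          if J = ∅ then 1 - ∑' i, a i else 0)) := by
      simp only [← sum_powerset_neg_one_pow_mul]
      refine hasSum_sum fun J _ => HasSum.mul_left _ ?_
      split_ifs with hJ
      · subst hJ
        simpa [classProb_one] using hs.hasSum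
      · rw [sub_zero]
        have := Finset.card_pos.2 (Finset.nonempty_iff_ne_empty.2 hJ)
        exact h _ (by omega)
    have h2 := h1.nonneg fun i => mul_nonneg (ha i) (pow_nonneg (sub_nonneg.2 (ha1 i)) K)
    simp only [mul_sub] at h2
    rw [Finset.sum_sub_distrib, ← measureReal_isolatedUpTo] at h2
    simp only [mul_ite, mul_zero] at h2
    rw [Finset.sum_ite_eq' _ ∅, if_pos (Finset.empty_mem_powerset _)] at h2
    simp at h2
    linarith
  have := ge_of_tendsto' (tendsto_measure_isolatedUpTo (μ := μ)) key
  linarith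

end Mass

/-! ### Class probabilities of `ν_α` and the choice of the parameter -/

section Realization

theorem injective_natCast_add_one : Function.Injective fun n : ℕ => (n : ℤ) + 1 :=
  fun m n h => by simpa using h

/-- The parameter with positive entries `a₀ ≥ a₁ ≥ …` only. -/
def ThomaParameter.ofAntitone (a : ℕ → ℝ) (ha : Antitone a) (h0 : ∀ i, 0 ≤ a i)
    (h1 : HasSum a 1) : ThomaParameter where
  val i := if 0 < i then a (i.toNat - 1) else 0
  nonneg i := by
    split_ifs
    · exact h0 _
    · exact le_rfl
  anti_pos i hi := by
    rw [if_pos hi, if_pos (by omega)]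
    exact ha (by omega)
  anti_neg i hi := by
    rw [if_neg (by omega), if_neg (by omega)]
  hasSum := by
    rw [← injective_natCast_add_one.hasSum_iff]
    · convert h1 using 1
      funext n
      rw [Function.comp, if_pos (by omega)]
      congr 1
    · intro i hi
      refine if_neg fun hpos => hi ⟨i.toNat - 1, ?_⟩
      simp only
      omega

variable {ξ : ℕ → ℤ}

theorem apply_eq_of_mem_youngGenerators {h : SInf} (hh : h ∈ youngGenerators ξ) (n : ℕ) :
    ξ (h.1 n) = ξ n := by
  obtain ⟨i, hi⟩ := hh
  have hs : h ∈ SInf.symOn (levelBlock ξ i) := hi.elim (fun h => h.2) fun h => h.2.1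
  by_cases hn : h.1 n = n
  · rw [hn]
  · have h1 : ξ n = i := not_not.1 fun h' => hn (hs n h')
    have h2 : ξ (h.1 n) = i := not_not.1 fun h' => hn (h.1.injective (hs (h.1 n) h'))
    rw [h1, h2]

theorem apply_eq_of_mem_youngSubgroup {h : SInf}
    (hh : h ∈ (signedPartitionOf ξ).youngSubgroup) (n : ℕ) : ξ (h.1 n) = ξ n := by
  obtain ⟨l, rfl, hl⟩ := mem_youngSubgroup_iff_exists_list.1 hh
  clear hh
  induction l with
  | nil => rfl
  | cons g l ih =>
    rw [List.prod_cons, SInf.mul_apply, apply_eq_of_mem_youngGenerators (hl g (by simp))]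
    exact ih fun h hh => hl h (by simp [hh])

theorem tr_mem_youngSubgroup (hξ : ∀ n, 0 < ξ n) {m n : ℕ} (h : ξ m = ξ n) :
    SInf.tr m n ∈ (signedPartitionOf ξ).youngSubgroup := by
  rw [youngSubgroup_eq_closure]
  refine Subgroup.subset_closure ⟨ξ m, Or.inl ⟨hξ m, fun k hk => SInf.tr_of_ne ?_ ?_⟩⟩
  · rintro rfl
    exact hk rfl
  · rintro rfl
    exact hk h.symm

/-- Equal positive labels are joined by a transposition in the subgroup. A repeated label leaves no
fixed points, so distinct labels are never merged through the fixed-point class. -/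
theorem orbitClass_youngSubgroup (hξ : ∀ n, 0 < ξ n) (hξ' : ∀ n, ∃ m, m ≠ n ∧ ξ m = ξ n)
    (m n : ℕ) : orbitClass (signedPartitionOf ξ).youngSubgroup m n ↔ ξ m = ξ n := by
  constructor
  · rintro (⟨h, hh, rfl⟩ | ⟨hm, _⟩)
    · exact (apply_eq_of_mem_youngSubgroup hh m).symm
    · obtain ⟨k, hk, hkm⟩ := hξ' m
      have := hm _ (tr_mem_youngSubgroup hξ hkm)
      rw [SInf.tr_right] at this
      exact absurd this hk
  · intro h
    exact Or.inl ⟨_, tr_mem_youngSubgroup hξ h, SInf.tr_left m n⟩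

namespace ThomaParameter

variable (α : ThomaParameter)

theorem bernoulli_forall_eq (s : Finset ℕ) (i : ℤ) :
    α.bernoulli {ξ | ∀ n ∈ s, ξ n = i} = ENNReal.ofReal (α.val i) ^ s.card := by
  have h := Measure.infinitePi_pi (fun _ : ℕ => α.pmf.toMeasure) (s := s) (t := fun _ => {i})
    fun _ _ => MeasurableSet.singleton i
  have h1 : Set.pi (s : Set ℕ) (fun _ : ℕ => ({i} : Set ℤ)) = {ξ | ∀ n ∈ s, ξ n = i} := by
    ext ξ
    simp
  rw [h1, Finset.prod_const, PMF.toMeasure_apply_singleton _ _ (MeasurableSet.singleton i)] at h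
  exact h

theorem ae_pos (hα : ∀ i ≤ 0, α.val i = 0) : ∀ᵐ ξ ∂α.bernoulli, ∀ n, 0 < ξ n := by
  have h : ∀ n : ℕ, ∀ i : ℤ, ∀ᵐ ξ ∂α.bernoulli, i ≤ 0 → ξ n ≠ i := by
    intro n i
    by_cases hi : i ≤ 0
    · have := α.bernoulli_forall_eq {n} i
      rw [hα i hi, ENNReal.ofReal_zero, Finset.card_singleton, pow_one,
        measure_eq_zero_iff_ae_notMem] at this
      filter_upwards [this] with ξ hξ _
      simpa using hξ
    · exact Filter.Eventually.of_forall fun ξ h => absurd h hi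
  filter_upwards [ae_all_iff.2 fun n => ae_all_iff.2 (h n)] with ξ hξ n
  by_contra hn
  exact hξ n (ξ n) (not_lt.1 hn) rfl

/-- For a given label, the events that it occurs exactly at `k` are disjoint and equally likely,
hence null. -/
theorem ae_exists_ne : ∀ᵐ ξ ∂α.bernoulli, ∀ n, ∃ m, m ≠ n ∧ ξ m = ξ n := by
  let D : ℤ → ℕ → Set (ℕ → ℤ) := fun i k => {ξ | ∀ j, ξ j = i ↔ j = k}
  have hm : ∀ i k, MeasurableSet (D i k) := by
    intro i k
    simp only [D, Set.ofPred_forall]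
    refine MeasurableSet.iInter fun j => ?_
    have hj : MeasurableSet {ξ : ℕ → ℤ | ξ j = i} :=
      measurable_pi_apply (X := fun _ : ℕ => ℤ) j (MeasurableSet.singleton i)
    by_cases hjk : j = k
    · simpa only [hjk, iff_true] using hjk ▸ hj
    · simp only [hjk, iff_false]
      exact hj.compl
  have he : ∀ i k, α.bernoulli (D i k) = α.bernoulli (D i 0) := by
    intro i k
    have h1 : (fun ξ : ℕ → ℤ => ξ ∘ Equiv.swap 0 k) ⁻¹' D i 0 = D i k := by
      ext ξ
      simp only [D, Set.mem_preimage, Set.mem_ofPred_eq, Function.comp]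
      rw [← (Equiv.swap 0 k).forall_congr_right (q := fun j => ξ j = i ↔ j = k)]
      refine forall_congr' fun j => ?_
      rw [Equiv.swap_apply_eq_iff, Equiv.swap_apply_right]
    rw [← h1]
    exact (measurePreserving_infinitePi_comp α.pmf.toMeasure _).measure_preimage
      (hm i 0).nullMeasurableSet
  have h0 : ∀ i k, ∀ᵐ ξ ∂α.bernoulli, ξ ∉ D i k := by
    intro i k
    rw [← measure_eq_zero_iff_ae_notMem, he]
    refine measure_eq_zero_of_pairwise_disjoint (hm i) ?_ (he i)
    intro k l hkl
    rw [Function.onFun, Set.disjoint_left]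
    exact fun ξ hk hl => hkl ((hl k).1 ((hk k).2 rfl))
  filter_upwards [ae_all_iff.2 fun i => ae_all_iff.2 (h0 i)] with ξ hξ n
  by_contra hcon
  push Not at hcon
  refine hξ (ξ n) n fun j => ⟨fun hj => ?_, fun hj => by rw [hj]⟩
  by_contra hne
  exact hcon j hne hj

/-- Almost surely the classes are the level sets of `ξ`. So `l` points share a class exactly when
all carry some common label `i`; as `l ≠ 0` these events are disjoint, with probabilities `α_i ^ l`.
-/
theorem hasSum_classProb_nu (hα : ∀ i ≤ 0, α.val i = 0) {l : ℕ} (hl : l ≠ 0) :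
    HasSum (fun i => α.val i ^ l) (classProb α.nu l) := by
  have h1 : α.nu (sameClass (Finset.range l)) =
      α.bernoulli (⋃ i : ℤ, {ξ | ∀ n ∈ Finset.range l, ξ n = i}) := by
    rw [nu, Measure.map_apply measurable_youngSubgroup (measurableSet_sameClass _)]
    refine measure_congr ?_
    filter_upwards [α.ae_pos hα, α.ae_exists_ne] with ξ hξ hξ'
    refine propext ?_
    change (∀ m ∈ Finset.range l, ∀ n ∈ Finset.range l,
      orbitClass (signedPartitionOf ξ).youngSubgroup m n) ↔ _
    simp only [orbitClass_youngSubgroup hξ hξ']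
    constructor
    · intro h
      exact Set.mem_iUnion.2 ⟨ξ 0, fun n hn => h n hn 0 (Finset.mem_range.2 (by omega))⟩
    · intro h m hm n hn
      obtain ⟨i, hi⟩ := Set.mem_iUnion.1 h
      exact (hi m hm).trans (hi n hn).symm
  have hmeas : ∀ i : ℤ, MeasurableSet {ξ : ℕ → ℤ | ∀ n ∈ Finset.range l, ξ n = i} := by
    intro i
    simp only [Set.ofPred_forall]
    exact MeasurableSet.iInter fun n => MeasurableSet.iInter fun _ =>
      measurable_pi_apply (X := fun _ : ℕ => ℤ) n (MeasurableSet.singleton i)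
  have h2 : classProb α.nu l = ∑' i : ℤ, α.val i ^ l := by
    rw [classProb, measureReal_def, h1, measure_iUnion _ hmeas, ENNReal.tsum_toReal_eq]
    · refine tsum_congr fun i => ?_
      rw [bernoulli_forall_eq, Finset.card_range, ENNReal.toReal_pow,
        ENNReal.toReal_ofReal (α.nonneg i)]
    · exact fun i => measure_ne_top _ _
    · intro i j hij
      rw [Function.onFun, Set.disjoint_left]
      intro ξ hi hj
      have h0 : 0 ∈ Finset.range l := Finset.mem_range.2 (by omega)
      exact hij ((hi 0 h0).symm.trans (hj 0 h0))
  have hle : ∀ i, α.val i ≤ 1 := fun i => le_hasSum α.hasSum i fun j _ => α.nonneg j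
  have hs : Summable fun i => α.val i ^ l :=
    Summable.of_nonneg_of_le (fun i => pow_nonneg (α.nonneg i) l)
      (fun i => pow_le_of_le_one (α.nonneg i) (hle i) hl) α.hasSum.summable
  rw [h2]
  exact hs.hasSum

end ThomaParameter

theorem IsErgodicADMeasure.exists_adCongruent_nu {μ : Measure (Subgroup SInf)}
    (hμ : IsErgodicADMeasure μ) : ∃ α : ThomaParameter, ADCongruent μ α.nu := by
  have := hμ.isProbabilityMeasure
  have := hμ.ergodic
  obtain ⟨a, ha, ha0, has, ha1, hap⟩ := exists_hasSum_pow_classProb (μ := μ)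
  have hsum : HasSum a 1 := by
    rw [← le_antisymm ha1 (one_le_tsum_of_hasSum_classProb ha0 has ha1 hap)]
    exact has.hasSum
  -- Congruence only compares class probabilities, so all frequencies may be put on positive labels.
  let α := ThomaParameter.ofAntitone a ha ha0 hsum
  have hα : ∀ i ≤ 0, α.val i = 0 := fun i hi => if_neg (by omega)
  refine ⟨α, adCongruent_of_classProb_eq hμ α.isErgodicADMeasure_nu fun k hk => ?_⟩
  have hk0 : k ≠ 0 := by omega
  refine (hap k hk).unique ?_
  have h1 := α.hasSum_classProb_nu hα hk0
  rw [← injective_natCast_add_one.hasSum_iff] at h1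
  · convert h1 using 1
    funext n
    change a n ^ k = (if 0 < (n : ℤ) + 1 then a (((n : ℤ) + 1).toNat - 1) else 0) ^ k
    rw [if_pos (by omega)]
    congr 2
  · intro i hi
    have : ¬ 0 < i := fun hpos => hi ⟨i.toNat - 1, by simp only; omega⟩
    rw [hα i (not_lt.1 this), zero_pow hk0]

end Realization

end

/-- Each `ν_α` is an ergodic AD-invariant Borel probability measure on the lattice of subgroups of
the infinite symmetric group, and each such measure is congruent to some `ν_α`. -/
theorem theorem16 :
    (∀ α : ThomaParameter, IsErgodicADMeasure α.nu) ∧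
    (∀ μ : Measure (Subgroup SInf), IsErgodicADMeasure μ →
      ∃ α : ThomaParameter, ADCongruent μ α.nu) :=
  ⟨fun α => α.isErgodicADMeasure_nu, fun _ hμ => hμ.exists_adCongruent_nu⟩
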